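/- Write $e(x)=e^{2\pi i x}$ and let $\tilde\Phi(u)=\int_0^\infty \Phi(x)x^{u-1}\,dx$ denote the Mellin transform. All complex powers are principal values, so that negative real numbers have argument $\pi$. Let $a\in\mathbb C$ with $\operatorname{Re}(a)>-2$, let $h_1:[-1,1]\to\mathbb C$ be smooth on $(-1,1)$ and up to the boundary, and put $h_a(x)=|1-x^2|^{a/2}h_1(x)$. Let $c_m^{\pm}\in\mathbb C$ be the coefficients of asymptotic expansions at $\pm1$, $$h_a(\pm(1-x))\sim |x|^{a/2}\sum_{m=0}^\infty c_m^{\pm}x^m\qquad (x\to0^+),$$ that is, for every $N\ge 0$ the difference of the left side and $|x|^{a/2}\sum_{m=0}^N c^\pm_m x^m$ is $O(x^{\operatorname{Re}(a)/2+N+1})$. Let $\Phi\in\mathcal S(\mathbb R)$ be a Schwartz function, let $\sigma\in\{1,-1\}$ and put $\Phi_\sigma(x)=\Phi(\sigma x)$. (It is enough that $\Phi_\sigma$ is smooth on $(0,\infty)$ with $\sup_{x>0}|x^\alpha\Phi_\sigma^{(\beta)}(x)|<\infty$ for all integers $\alpha,\beta\ge0$.) For an integer $m\ge 0$, real $\tau>0$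 and real $x\neq0$ define $$\mathcal A_{h_a,m}^{\tau,\pm}(\Phi_\sigma)(x)=\frac1{2\pi i}\int_{\operatorname{Re}(u)=\tau}\tilde\Phi_\sigma(u)\,c_m^{\pm}\!\left(\tfrac u2\right)\Gamma\!\left(m+1+\tfrac{a+u}2\right)x^{-u/2}\,du,$$ $$c_m^{\pm}\!\left(\tfrac u2\right)=\left(\tfrac{i}{2\pi}\right)^{1+m+\frac{u+a}2}2^{u/2}\sum_{\substack{j+k=m\\ j,k\ge0}}\frac{c_k^{\pm}}{(-2)^j}\binom{u/2}{j}.$$ Let $M\ge0$ be an integer, and let $\tau_1>0$; if $\tilde\Phi_\sigma(u)$ has at most a simple pole at $u=0$, then $\tau_1=0$ is allowed as well. Then for all $\tau>0$ and all $C,D\in\mathbb R\setminus\{0\}$ with $\operatorname{sgn}(C)=\sigma$, the integrals below and those defining $\mathcal A_{h_a,m}^{\tau,\pm}(\Phi_\sigma)(\mp C^2D)$, $m\ge0$, converge absolutely, and $$\int_{-1}^1h_a(x)\,\Phi\!\left(\tfrac{C}{\sqrt{1-x^2}}\right)e(xD)\,dx=\sum_{m=0}^{M}\sum_{\pm}\frac{e(\pm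 D)\,\mathcal A_{h_a,m}^{\tau,\pm}(\Phi_\sigma)(\mp C^2D)}{(\mp D)^{m+1+\frac a2}}+O\!\left((C^2|D|)^{-\tau_1}|D|^{-(M+2+\frac{\operatorname{Re}(a)}2)}\right),$$ where the implied constant depends only on $h_1$, $\Phi$, $a$, $M$ and $\tau_1$ (and not on $C$, $D$, $\tau$). -/

import Mathlib

open Set Filter Topology MeasureTheory
open scoped ContDiff

noncomputable section

/-- The additive character `e(x) = exp(2πix)`. -/
def addE (x : ℝ) : ℂ := Complex.exp (2 * Real.pi * Complex.I * x)

/-- `h_a(x) = |1 - x²|^{a/2} h₁(x)`, for a complex exponent `a`. -/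
def singularWeight (a : ℂ) (h₁ : ℝ → ℂ) (x : ℝ) : ℂ :=
  ((|1 - x ^ 2| : ℝ) : ℂ) ^ (a / 2) * h₁ x

/-- The asymptotic expansion `f(x) ∼ |x|^β ∑_{m ≥ 0} c_m x^m` as `x → 0⁺`: for every `N`, the
difference of `f` and the partial sum up to `m = N` is `O(x^{β + N + 1})`. -/
def HasAsympExpansion (f : ℝ → ℂ) (β : ℂ) (c : ℕ → ℂ) : Prop :=
  ∀ N : ℕ,
    (fun x : ℝ => f x - ((|x| : ℝ) : ℂ) ^ β * ∑ m ∈ Finset.range (N + 1), c m * (x : ℂ) ^ m)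
      =O[𝓝[>] 0] fun x : ℝ => x ^ (β.re + N + 1)

/-- `Φ` is a Schwartz function on the positive half-line: it is smooth on `(0, ∞)` and
`x^α Φ^{(β)}(x)` is bounded on `(0, ∞)` for all natural numbers `α`, `β`. -/
def IsSchwartzOnPos (Φ : ℝ → ℂ) : Prop :=
  ContDiffOn ℝ ∞ Φ (Ioi 0) ∧
    ∀ α β : ℕ, ∃ B : ℝ, ∀ x : ℝ, 0 < x → x ^ α * ‖iteratedDeriv β Φ x‖ ≤ B

/-- The Mellin transform of `Φ`, defined by its integral for `Re u > 0`, has at most a simple pole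
at `u = 0`: `u ↦ u * mellin Φ u` agrees near `0`, in the right half-plane, with a function that is
analytic at `0`. -/
def MellinAtMostSimplePoleAtZero (Φ : ℝ → ℂ) : Prop :=
  ∃ g : ℂ → ℂ, AnalyticAt ℂ g 0 ∧
    ∀ᶠ u in 𝓝[{u : ℂ | 0 < u.re}] (0 : ℂ), u * mellin Φ u = g u

/-- The function `c_m(u/2)` attached to the coefficients `c_k` of the expansion:
`(i/2π)^{1+m+(u+a)/2} 2^{u/2} ∑_{j+k=m} c_k (-2)^{-j} binom(u/2, j)`. -/
def twistedCoeff (a : ℂ) (c : ℕ → ℂ) (m : ℕ) (u : ℂ) : ℂ :=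
  (Complex.I / (2 * Real.pi)) ^ (1 + (m : ℂ) + (u + a) / 2) * (2 : ℂ) ^ (u / 2) *
    ∑ p ∈ Finset.HasAntidiagonal.antidiagonal m, c p.2 / (-2 : ℂ) ^ p.1 * Ring.choose (u / 2) p.1

/-- The integrand `Φ̃(u) c_m(u/2) Γ(m+1+(a+u)/2) x^{-u/2}` of the integral transform
(all powers are principal values, so that a negative real number has argument `π`). -/
def transformIntegrand (a : ℂ) (c : ℕ → ℂ) (m : ℕ) (Φ : ℝ → ℂ) (x : ℝ) (u : ℂ) : ℂ :=
  mellin Φ u * twistedCoeff a c m u * Complex.Gamma ((m : ℂ) + 1 + (a + u) / 2) *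
    (x : ℂ) ^ (-u / 2)

/-- The integral transform `(1/2πi) ∫_{(τ)} Φ̃(u) c_m(u/2) Γ(m+1+(a+u)/2) x^{-u/2} du` along the
vertical line `Re u = τ`, parametrised by `u = τ + it`. -/
def mellinBarnes (a : ℂ) (c : ℕ → ℂ) (m : ℕ) (τ : ℝ) (Φ : ℝ → ℂ) (x : ℝ) : ℂ :=
  1 / (2 * Real.pi) * ∫ t : ℝ, transformIntegrand a c m Φ x (τ + t * Complex.I)

end

/-!
Write `φ(y) = Φ(σy)`, `c = |C|` and `κ = 2 / c²`. A smooth cutoff, which together with its reflection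
is a partition of unity, splits the integral into the contributions of the two endpoints; they are
exchanged by `x ↦ -x`, `D ↦ -D`. At the endpoint `x = 1` put `t = 1 - x`, so that
`1 - x² = t (2 - t)`: the integrand becomes a cutoff times `t^{a/2} g(t) w(κ (t - t²/2)) e(-tD)`, with
`g` smooth up to `t = 0` and `w(s) = φ(s^{-1/2})`.

The argument takes place on the `t`-line, and the Mellin variable enters only to identify the main
terms. Replacing `g` by its Taylor polynomial, and `w(κ (t - t²/2))` by its Taylor polynomial at `κt`
in powers of `-κt²/2`, produces the terms `t^{a/2+k+j} V_j((κt)^{-1/2})`, where `V_j` is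
`j! binom(-(y/2) d/dy, j)` applied to `φ` (`eulerFalling`). Let `n ≥ 0` be the real number `τ₁`.
The difference between the integrand and this expansion up to `k + j ≤ M` is a symbol on `(0, ∞)`:
all its Euler derivatives `(t d/dt)^i` are `O(κ^n t^{Re a/2 + M + 1 + n})`, uniformly in `κ`
(`symbolFamily_endpointRemainder`). This uses that `s^i w^{(i)}(s) = O(s^n)`, which holds also for
`n = 0` because all derivatives of `φ` are bounded on `(0, ∞)`. Both kinds of Taylor remainders are
symbols because the Euler operator maps remainders to combinations of remainders
(`hasDerivWithinAt_taylorRemainder`, `hasDerivAt_dilationRemainder`).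

The Laplace transform at `z` of a symbol of order `β > -1` is `O(|z|^{-(β+1)})`, uniformly for
`Re z > 0`: trivially for `t ≤ 1/|z|`, and by repeated integration by parts beyond
(`SymbolFamily.norm_integral_le`). Letting `z` tend to `2πiD` gives exactly the claimed error term.

It remains to compute the Laplace transforms of the terms of the expansion. By Mellin inversion on
any line `Re u = τ > 0` and Euler's integral along a rotated ray, they are Mellin–Barnes integrals of
`Ṽ_j(u) κ^{u/2} z^{-s} Γ(s)` with `s = a/2 + k + j + 1 + u/2`
(`integral_cpow_mul_eulerFalling_mul_exp`). The Mellin transform `Ṽ_j(u)` is `j! binom(u/2, j)` times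
that of `φ`, and decays rapidly, whereas `z^{-s} Γ(s)` grows at most polynomially, uniformly up to the
imaginary axis (`norm_cpow_neg_mul_Gamma_le`). Hence these integrals converge absolutely, extend
continuously to `z = 2πiD`, and sum up there to the transforms in the statement (`mellinBarnes_div`).
Since the left sides do not involve `τ`, neither does the implied constant.
-/

/-! ### Symbol families and their Laplace transforms -/

/-- Symbol families of finite regularity. For a family `f κ`, `κ > 0`, of functions on
`U ⊆ (0, ∞)`, `SymbolFamily U β n K f` says that the Euler derivatives `(t d/dt)^i (f κ)`, `i ≤ K`,
exist on `U` and are `O(κ^n t^β)`, uniformly in `κ > 0` and `t ∈ U`. -/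
def SymbolFamily (U : Set ℝ) (β n : ℝ) : ℕ → (ℝ → ℝ → ℂ) → Prop
  | 0, f => ∃ B : ℝ, ∀ κ : ℝ, 0 < κ → ∀ t ∈ U, ‖f κ t‖ ≤ B * κ ^ n * t ^ β
  | K + 1, f => (∃ B : ℝ, ∀ κ : ℝ, 0 < κ → ∀ t ∈ U, ‖f κ t‖ ≤ B * κ ^ n * t ^ β) ∧
      (∀ κ : ℝ, 0 < κ → ∀ t ∈ U, DifferentiableAt ℝ (f κ) t) ∧
      SymbolFamily U β n K (fun κ t => t * deriv (f κ) t)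

namespace SymbolFamily

variable {U : Set ℝ} {β β' n n' : ℝ} {K : ℕ} {f g : ℝ → ℝ → ℂ}

theorem bound (h : SymbolFamily U β n K f) :
    ∃ B : ℝ, ∀ κ : ℝ, 0 < κ → ∀ t ∈ U, ‖f κ t‖ ≤ B * κ ^ n * t ^ β := by
  cases K with
  | zero => exact h
  | succ K => exact h.1

theorem differentiableAt (h : SymbolFamily U β n (K + 1) f) {κ : ℝ} (hκ : 0 < κ) {t : ℝ}
    (ht : t ∈ U) : DifferentiableAt ℝ (f κ) t :=
  h.2.1 κ hκ t ht

theorem euler (h : SymbolFamily U β n (K + 1) f) :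
    SymbolFamily U β n K (fun κ t => t * deriv (f κ) t) :=
  h.2.2

theorem of_succ (h : SymbolFamily U β n (K + 1) f) : SymbolFamily U β n K f := by
  induction K generalizing f with
  | zero => exact h.1
  | succ K ih => exact ⟨h.1, h.2.1, ih h.2.2⟩

theorem congr (hU : IsOpen U) (h : SymbolFamily U β n K f)
    (hfg : ∀ κ : ℝ, 0 < κ → ∀ t ∈ U, g κ t = f κ t) : SymbolFamily U β n K g := by
  induction K generalizing f g with
  | zero =>
    obtain ⟨B, hB⟩ := h
    exact ⟨B, fun κ hκ t ht => by rw [hfg κ hκ t ht]; exact hB κ hκ t ht⟩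
  | succ K ih =>
    obtain ⟨⟨B, hB⟩, hd, hK⟩ := h
    have hev : ∀ κ : ℝ, 0 < κ → ∀ t ∈ U, g κ =ᶠ[𝓝 t] f κ := fun κ hκ t ht => by
      filter_upwards [hU.mem_nhds ht] with x hx using hfg κ hκ x hx
    refine ⟨⟨B, fun κ hκ t ht => by rw [hfg κ hκ t ht]; exact hB κ hκ t ht⟩,
      fun κ hκ t ht => (hd κ hκ t ht).congr_of_eventuallyEq (hev κ hκ t ht),
      ih hK fun κ hκ t ht => ?_⟩
    rw [(hev κ hκ t ht).deriv_eq]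

theorem of_hasDerivAt {f' : ℝ → ℝ → ℂ} (hU : IsOpen U)
    (hb : ∃ B : ℝ, ∀ κ : ℝ, 0 < κ → ∀ t ∈ U, ‖f κ t‖ ≤ B * κ ^ n * t ^ β)
    (hd : ∀ κ : ℝ, 0 < κ → ∀ t ∈ U, HasDerivAt (f κ) (f' κ t) t)
    (hf' : SymbolFamily U β n K (fun κ t => t * f' κ t)) : SymbolFamily U β n (K + 1) f :=
  ⟨hb, fun κ hκ t ht => (hd κ hκ t ht).differentiableAt,
    hf'.congr hU fun κ hκ t ht => by rw [(hd κ hκ t ht).deriv]⟩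

theorem union {V : Set ℝ} (hf : SymbolFamily U β n K f) (hg : SymbolFamily V β n K f)
    (hU0 : U ⊆ Ioi 0) (hV0 : V ⊆ Ioi 0) : SymbolFamily (U ∪ V) β n K f := by
  have key : ∀ f : ℝ → ℝ → ℂ, SymbolFamily U β n 0 f → SymbolFamily V β n 0 f →
      SymbolFamily (U ∪ V) β n 0 f := by
    rintro f ⟨B, hB⟩ ⟨B', hB'⟩
    refine ⟨max B B', fun κ hκ t ht => ?_⟩
    have h0 : 0 < t := ht.elim (fun h => hU0 h) (fun h => hV0 h)
    have h1 : 0 ≤ κ ^ n * t ^ β := by positivity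
    rcases ht with ht | ht
    · refine (hB κ hκ t ht).trans ?_
      rw [mul_assoc, mul_assoc]
      exact mul_le_mul_of_nonneg_right (le_max_left _ _) h1
    · refine (hB' κ hκ t ht).trans ?_
      rw [mul_assoc, mul_assoc]
      exact mul_le_mul_of_nonneg_right (le_max_right _ _) h1
  induction K generalizing f with
  | zero => exact key f hf hg
  | succ K ih =>
    exact ⟨key f hf.1 hg.1, fun κ hκ t ht => ht.elim (hf.2.1 κ hκ t) (hg.2.1 κ hκ t),
      ih hf.2.2 hg.2.2⟩

theorem mono {V : Set ℝ} (h : SymbolFamily U β n K f) (hVU : V ⊆ U) : SymbolFamily V β n K f := by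
  have key : ∀ f : ℝ → ℝ → ℂ, SymbolFamily U β n 0 f → SymbolFamily V β n 0 f := by
    rintro f ⟨B, hB⟩
    exact ⟨B, fun κ hκ t ht => hB κ hκ t (hVU ht)⟩
  induction K generalizing f with
  | zero => exact key f h
  | succ K ih => exact ⟨key f h.1, fun κ hκ t ht => h.2.1 κ hκ t (hVU ht), ih h.2.2⟩

theorem add (hU : IsOpen U) (hf : SymbolFamily U β n K f) (hg : SymbolFamily U β n K g) :
    SymbolFamily U β n K (fun κ t => f κ t + g κ t) := by
  have key : ∀ f g : ℝ → ℝ → ℂ, SymbolFamily U β n 0 f → SymbolFamily U β n 0 g →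
      SymbolFamily U β n 0 (fun κ t => f κ t + g κ t) := by
    rintro f g ⟨B, hB⟩ ⟨B', hB'⟩
    refine ⟨B + B', fun κ hκ t ht => (norm_add_le _ _).trans ?_⟩
    rw [add_mul, add_mul]
    exact add_le_add (hB κ hκ t ht) (hB' κ hκ t ht)
  induction K generalizing f g with
  | zero => exact key f g hf hg
  | succ K ih =>
    refine of_hasDerivAt hU (key f g hf.1 hg.1)
      (fun κ hκ t ht => (hf.2.1 κ hκ t ht).hasDerivAt.add (hg.2.1 κ hκ t ht).hasDerivAt) ?_
    simp only [mul_add]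
    exact ih hf.2.2 hg.2.2

theorem const_mul (hU : IsOpen U) (c : ℂ) (hf : SymbolFamily U β n K f) :
    SymbolFamily U β n K (fun κ t => c * f κ t) := by
  have key : ∀ f : ℝ → ℝ → ℂ, SymbolFamily U β n 0 f →
      SymbolFamily U β n 0 (fun κ t => c * f κ t) := by
    rintro f ⟨B, hB⟩
    refine ⟨‖c‖ * B, fun κ hκ t ht => ?_⟩
    rw [norm_mul, mul_assoc, mul_assoc]
    refine mul_le_mul_of_nonneg_left ?_ (norm_nonneg _)
    rw [← mul_assoc]
    exact hB κ hκ t ht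
  induction K generalizing f with
  | zero => exact key f hf
  | succ K ih =>
    refine of_hasDerivAt hU (key f hf.1)
      (fun κ hκ t ht => (hf.2.1 κ hκ t ht).hasDerivAt.const_mul c) ?_
    refine (ih hf.2.2).congr hU fun κ hκ t ht => ?_
    ring

theorem neg (hU : IsOpen U) (hf : SymbolFamily U β n K f) :
    SymbolFamily U β n K (fun κ t => -f κ t) := by
  simpa using hf.const_mul hU (-1)

theorem sub (hU : IsOpen U) (hf : SymbolFamily U β n K f) (hg : SymbolFamily U β n K g) :
    SymbolFamily U β n K (fun κ t => f κ t - g κ t) := by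
  simpa [sub_eq_add_neg] using hf.add hU (hg.neg hU)

theorem zero (hU : IsOpen U) : SymbolFamily U β n K (fun _ _ => 0) := by
  induction K with
  | zero => exact ⟨0, fun κ _ t _ => by simp⟩
  | succ K ih =>
    exact of_hasDerivAt hU ⟨0, fun κ _ t _ => by simp⟩ (fun κ _ t _ => hasDerivAt_const t (0 : ℂ))
      (by simpa using ih)

theorem sum {ι : Type*} (hU : IsOpen U) (s : Finset ι) {F : ι → ℝ → ℝ → ℂ}
    (hF : ∀ i ∈ s, SymbolFamily U β n K (F i)) :
    SymbolFamily U β n K (fun κ t => ∑ i ∈ s, F i κ t) := by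
  classical
  induction s using Finset.induction_on with
  | empty => simpa using zero hU
  | insert i s hi ih =>
    simp only [Finset.sum_insert hi]
    exact (hF i (Finset.mem_insert_self i s)).add hU
      (ih fun j hj => hF j (Finset.mem_insert_of_mem hj))

theorem mul (hU : IsOpen U) (hU0 : U ⊆ Ioi 0) (hf : SymbolFamily U β n K f)
    (hg : SymbolFamily U β' n' K g) :
    SymbolFamily U (β + β') (n + n') K (fun κ t => f κ t * g κ t) := by
  have key : ∀ f g : ℝ → ℝ → ℂ, SymbolFamily U β n 0 f → SymbolFamily U β' n' 0 g →
      SymbolFamily U (β + β') (n + n') 0 (fun κ t => f κ t * g κ t) := by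
    rintro f g ⟨B, hB⟩ ⟨B', hB'⟩
    refine ⟨B * B', fun κ hκ t ht => ?_⟩
    rw [norm_mul, Real.rpow_add hκ, Real.rpow_add (hU0 ht)]
    calc ‖f κ t‖ * ‖g κ t‖ ≤ (B * κ ^ n * t ^ β) * (B' * κ ^ n' * t ^ β') :=
          mul_le_mul (hB κ hκ t ht) (hB' κ hκ t ht) (norm_nonneg _)
            ((norm_nonneg _).trans (hB κ hκ t ht))
      _ = _ := by ring
  induction K generalizing f g with
  | zero => exact key f g hf hg
  | succ K ih =>
    refine of_hasDerivAt hU (key f g hf.bound hg.bound)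
      (fun κ hκ t ht => (hf.2.1 κ hκ t ht).hasDerivAt.mul (hg.2.1 κ hκ t ht).hasDerivAt) ?_
    refine ((ih hf.2.2 hg.of_succ).add hU (ih hf.of_succ hg.2.2)).congr hU fun κ hκ t ht => ?_
    ring

/-- Lowering the order on a bounded set, at the cost of a constant. -/
theorem of_le_of_bounded {T : ℝ} (h : SymbolFamily U β n K f) (hU0 : U ⊆ Ioc 0 T)
    (hβ : β' ≤ β) : SymbolFamily U β' n K f := by
  have key : ∀ f : ℝ → ℝ → ℂ, SymbolFamily U β n 0 f → SymbolFamily U β' n 0 f := by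
    rintro f ⟨B, hB⟩
    refine ⟨|B| * T ^ (β - β'), fun κ hκ t ht => (hB κ hκ t ht).trans ?_⟩
    have h0 : 0 < t := (hU0 ht).1
    have h1 : t ^ β = t ^ (β - β') * t ^ β' := by rw [← Real.rpow_add h0]; simp
    have h2 : t ^ (β - β') ≤ T ^ (β - β') :=
      Real.rpow_le_rpow h0.le (hU0 ht).2 (sub_nonneg.2 hβ)
    calc B * κ ^ n * t ^ β ≤ |B| * κ ^ n * t ^ β := by gcongr; exact le_abs_self B
      _ = |B| * κ ^ n * (t ^ (β - β') * t ^ β') := by rw [h1]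
      _ ≤ |B| * κ ^ n * (T ^ (β - β') * t ^ β') := by gcongr
      _ = _ := by ring
  induction K generalizing f with
  | zero => exact key f h
  | succ K ih => exact ⟨key f h.1, h.2.1, ih h.2.2⟩

/-- Complex powers `t ^ μ` are symbols of order `Re μ`. -/
theorem cpow (hU : IsOpen U) (hU0 : U ⊆ Ioi 0) (μ : ℂ) :
    SymbolFamily U μ.re 0 K (fun _ t => (t : ℂ) ^ μ) := by
  have hb : ∃ B : ℝ, ∀ κ : ℝ, 0 < κ → ∀ t ∈ U, ‖(t : ℂ) ^ μ‖ ≤ B * κ ^ (0 : ℝ) * t ^ μ.re :=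
    ⟨1, fun κ _ t ht => by simp [Complex.norm_cpow_eq_rpow_re_of_pos (show 0 < t from hU0 ht)]⟩
  induction K with
  | zero => exact hb
  | succ K ih =>
    rcases eq_or_ne μ 0 with rfl | hμ
    · refine of_hasDerivAt hU hb (f' := fun _ _ => 0) (fun κ _ t _ => ?_) ?_
      · simpa using hasDerivAt_const t (1 : ℂ)
      · simpa using zero hU
    · refine of_hasDerivAt hU hb
        (fun κ _ t ht => hasDerivAt_ofReal_cpow_const (show 0 < t from hU0 ht).ne' hμ) ?_
      refine (ih.const_mul hU μ).congr hU fun κ _ t ht => ?_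
      have h0 : (t : ℂ) ≠ 0 := by exact_mod_cast (show 0 < t from hU0 ht).ne'
      rw [Complex.cpow_sub _ _ h0, Complex.cpow_one]
      field_simp

theorem pow (hU : IsOpen U) (hU0 : U ⊆ Ioi 0) (m : ℕ) :
    SymbolFamily U m 0 K (fun _ t => (t : ℂ) ^ m) := by
  simpa using cpow (K := K) hU hU0 (m : ℂ)

theorem deriv (hU : IsOpen U) (hU0 : U ⊆ Ioi 0) (h : SymbolFamily U β n (K + 1) f) :
    SymbolFamily U (β - 1) n K (fun κ t => deriv (f κ) t) := by
  have := (h.euler.mul hU hU0 (cpow (K := K) hU hU0 (-1))).congr hU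
    (g := fun κ t => _root_.deriv (f κ) t) fun κ _ t ht => ?_
  · simpa [sub_eq_add_neg] using this
  · have h0 : (t : ℂ) ≠ 0 := by exact_mod_cast (show 0 < t from hU0 ht).ne'
    rw [Complex.cpow_neg_one]
    field_simp

/-- Gluing of symbols on two overlapping intervals that cover `(0, ∞)`. -/
theorem of_Ioo_of_Ioi {b d : ℝ} (hb : 0 ≤ b) (hbd : b < d) (h₁ : SymbolFamily (Ioo 0 d) β n K f)
    (h₂ : SymbolFamily (Ioi b) β n K f) : SymbolFamily (Ioi 0) β n K f := by
  refine (h₁.union h₂ (fun t ht => ht.1) (fun t ht => lt_of_le_of_lt hb ht)).mono fun t ht => ?_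
  rcases lt_or_ge t d with h | h
  · exact Or.inl ⟨ht, h⟩
  · exact Or.inr (hbd.trans_le h)

end SymbolFamily

theorem integrableOn_rpow_mul_exp_neg_Ioi (β : ℝ) {r ε : ℝ} (hr : 0 < r) (hε : 0 < ε) :
    IntegrableOn (fun t : ℝ => t ^ β * Real.exp (-ε * t)) (Ioi r) := by
  refine integrable_of_isBigO_exp_neg (b := ε / 2) (by positivity) ?_ ?_
  · intro t ht
    have h0 : t ≠ 0 := (hr.trans_le ht).ne'
    exact ((Real.continuousAt_rpow_const t β (Or.inl h0)).mul (by fun_prop)).continuousWithinAt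
  · have h1 := (isLittleO_rpow_exp_pos_mul_atTop β (half_pos hε)).isBigO.mul
      (Asymptotics.isBigO_refl (fun t : ℝ => Real.exp (-ε * t)) atTop)
    refine h1.congr_right fun t => ?_
    rw [← Real.exp_add]
    ring_nf

theorem hasDerivAt_exp_neg_mul (z : ℂ) (t : ℝ) :
    HasDerivAt (fun t : ℝ => Complex.exp (-z * t)) (Complex.exp (-z * t) * -z) t := by
  have h1 : HasDerivAt (fun t : ℝ => -z * (t : ℂ)) (-z) t := by
    simpa using (Complex.ofRealCLM.hasDerivAt (x := t)).const_mul (-z)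
  exact h1.cexp

theorem norm_exp_neg_mul_ofReal (z : ℂ) (t : ℝ) :
    ‖Complex.exp (-z * t)‖ = Real.exp (-z.re * t) := by
  simp [Complex.norm_exp]

namespace SymbolFamily

variable {β n : ℝ} {K : ℕ} {f : ℝ → ℝ → ℂ}

theorem integrableOn_Ioi_mul_exp {B : ℝ} {h : ℝ → ℂ} {z : ℂ} {r : ℝ}
    (hr : 0 < r) (hz : 0 < z.re) (hm : AEStronglyMeasurable h (volume.restrict (Ioi r)))
    (hB : ∀ t ∈ Ioi (0 : ℝ), ‖h t‖ ≤ B * t ^ β) :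
    IntegrableOn (fun t : ℝ => h t * Complex.exp (-z * t)) (Ioi r) := by
  refine Integrable.mono' ((integrableOn_rpow_mul_exp_neg_Ioi β hr hz).const_mul B)
    (hm.mul (by fun_prop)) ?_
  filter_upwards [ae_restrict_mem measurableSet_Ioi] with t ht
  rw [norm_mul, norm_exp_neg_mul_ofReal, ← mul_assoc]
  exact mul_le_mul_of_nonneg_right (hB t (hr.trans ht)) (Real.exp_pos _).le

/-- Repeated integration by parts on the tail `t > 1 / |z|` of the Laplace transform of a symbol. -/
theorem norm_integral_tail_le (h : SymbolFamily (Ioi 0) β n K f) (hK : β + 1 < K) :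
    ∃ A : ℝ, ∀ κ : ℝ, 0 < κ → ∀ z : ℂ, 0 < z.re →
      ‖∫ t in Ioi (‖z‖⁻¹), f κ t * Complex.exp (-z * t)‖ ≤ A * κ ^ n * ‖z‖ ^ (-(β + 1)) := by
  have hznorm : ∀ z : ℂ, 0 < z.re → 0 < ‖z‖ := fun z hz =>
    norm_pos_iff.2 fun h0 => by simp [h0] at hz
  induction K generalizing f β with
  | zero =>
    obtain ⟨B, hB⟩ := h
    have hβ : β < -1 := by simp at hK; linarith
    refine ⟨B * (-(β + 1))⁻¹, fun κ hκ z hz => ?_⟩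
    have hr : 0 < ‖z‖⁻¹ := inv_pos.2 (hznorm z hz)
    have hint := (integrableOn_Ioi_rpow_of_lt hβ hr).const_mul (B * κ ^ n)
    refine (norm_integral_le_of_norm_le hint ?_).trans (le_of_eq ?_)
    · filter_upwards [ae_restrict_mem measurableSet_Ioi] with t ht
      rw [norm_mul, norm_exp_neg_mul_ofReal]
      have ht0 : 0 < t := hr.trans ht
      have h1 := hB κ hκ t ht0
      refine (mul_le_of_le_one_right (norm_nonneg _) ?_).trans h1
      rw [Real.exp_le_one_iff]
      nlinarith [mul_pos hz ht0]
    · rw [integral_const_mul, integral_Ioi_rpow_of_lt hβ hr,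
        Real.inv_rpow (norm_nonneg z), ← Real.rpow_neg (norm_nonneg z)]
      have : β + 1 ≠ 0 := by linarith
      field_simp
  | succ K ih =>
    have hU0 : Ioi (0 : ℝ) ⊆ Ioi 0 := Subset.rfl
    have hd := h.deriv isOpen_Ioi hU0
    obtain ⟨A, hA⟩ := ih hd (by push_cast at hK; linarith)
    obtain ⟨B, hB⟩ := h.bound
    obtain ⟨B', hB'⟩ := hd.bound
    refine ⟨B + A, fun κ hκ z hz => ?_⟩
    have hz0 := hznorm z hz
    have hzne : z ≠ 0 := norm_pos_iff.1 hz0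
    set r := ‖z‖⁻¹ with hrdef
    have hr : 0 < r := inv_pos.2 hz0
    have hcont : ContinuousOn (f κ) (Ioi 0) := fun t ht =>
      (h.differentiableAt hκ ht).continuousAt.continuousWithinAt
    have hint1 : IntegrableOn (fun t : ℝ => f κ t * Complex.exp (-z * t)) (Ioi r) :=
      integrableOn_Ioi_mul_exp hr hz
        ((hcont.mono (Ioi_subset_Ioi hr.le)).aestronglyMeasurable measurableSet_Ioi)
        (fun t ht => hB κ hκ t ht)
    have hint2 : IntegrableOn (fun t : ℝ => _root_.deriv (f κ) t * Complex.exp (-z * t)) (Ioi r) :=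
      integrableOn_Ioi_mul_exp hr hz (stronglyMeasurable_deriv _).aestronglyMeasurable
        (fun t ht => hB' κ hκ t ht)
    have hderiv : ∀ t ∈ Ici r, HasDerivAt (fun t : ℝ => f κ t * Complex.exp (-z * t))
        (_root_.deriv (f κ) t * Complex.exp (-z * t) - z * (f κ t * Complex.exp (-z * t))) t := by
      intro t ht
      have := (h.differentiableAt hκ (hr.trans_le ht)).hasDerivAt.mul
        (hasDerivAt_exp_neg_mul z t)
      refine this.congr_deriv ?_
      ring
    have hlim : Tendsto (fun t : ℝ => f κ t * Complex.exp (-z * t)) atTop (𝓝 0) := by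
      have h0 := (tendsto_rpow_mul_exp_neg_mul_atTop_nhds_zero β z.re hz).const_mul (B * κ ^ n)
      rw [mul_zero] at h0
      refine squeeze_zero_norm' ?_ h0
      filter_upwards [eventually_gt_atTop 0] with t ht
      rw [norm_mul, norm_exp_neg_mul_ofReal, ← mul_assoc]
      exact mul_le_mul_of_nonneg_right (hB κ hκ t ht) (Real.exp_pos _).le
    have hibp := integral_Ioi_of_hasDerivAt_of_tendsto' hderiv (hint2.sub (hint1.const_mul z)) hlim
    rw [integral_sub hint2 (hint1.const_mul z), integral_const_mul] at hibp
    have hI : ∫ t in Ioi r, f κ t * Complex.exp (-z * t) =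
        z⁻¹ * (f κ r * Complex.exp (-z * r) +
          ∫ t in Ioi r, _root_.deriv (f κ) t * Complex.exp (-z * t)) := by
      rw [eq_inv_mul_iff_mul_eq₀ hzne]
      linear_combination -hibp
    have hpow : r * r ^ β = ‖z‖ ^ (-(β + 1)) := by
      rw [Real.rpow_neg hz0.le, ← Real.inv_rpow hz0.le, ← hrdef, Real.rpow_add hr, Real.rpow_one,
        mul_comm]
    have hpow2 : r * ‖z‖ ^ (-(β - 1 + 1)) = ‖z‖ ^ (-(β + 1)) := by
      rw [← hpow, sub_add_cancel, Real.rpow_neg hz0.le, ← Real.inv_rpow hz0.le]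
    rw [hI, norm_mul, norm_inv, ← hrdef]
    have hb1 : ‖f κ r * Complex.exp (-z * r)‖ ≤ B * κ ^ n * r ^ β := by
      rw [norm_mul, norm_exp_neg_mul_ofReal]
      refine (mul_le_of_le_one_right (norm_nonneg _) ?_).trans (hB κ hκ r hr)
      rw [Real.exp_le_one_iff]
      nlinarith [mul_pos hz hr]
    calc r * ‖f κ r * Complex.exp (-z * r) +
          ∫ t in Ioi r, _root_.deriv (f κ) t * Complex.exp (-z * t)‖
        ≤ r * (B * κ ^ n * r ^ β + A * κ ^ n * ‖z‖ ^ (-(β - 1 + 1))) :=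
          mul_le_mul_of_nonneg_left ((norm_add_le _ _).trans (add_le_add hb1 (hA κ hκ z hz))) hr.le
      _ = B * κ ^ n * (r * r ^ β) + A * κ ^ n * (r * ‖z‖ ^ (-(β - 1 + 1))) := by ring
      _ = _ := by rw [hpow, hpow2]; ring

theorem integrableOn_mul_exp (h : SymbolFamily (Ioi 0) β n (K + 1) f) (hβ : -1 < β) {κ : ℝ}
    (hκ : 0 < κ) {z : ℂ} (hz : 0 < z.re) :
    IntegrableOn (fun t : ℝ => f κ t * Complex.exp (-z * t)) (Ioi 0) := by
  obtain ⟨B, hB⟩ := h.bound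
  have hcont : ContinuousOn (f κ) (Ioi 0) := fun t ht =>
    (h.differentiableAt hκ ht).continuousAt.continuousWithinAt
  have hI : IntegrableOn (fun t : ℝ => t ^ β * Real.exp (-z.re * t)) (Ioi 0) := by
    simpa using integrableOn_rpow_mul_exp_neg_mul_rpow hβ one_pos hz
  refine Integrable.mono' (hI.const_mul (B * κ ^ n))
    ((hcont.aestronglyMeasurable measurableSet_Ioi).mul (by fun_prop)) ?_
  filter_upwards [ae_restrict_mem measurableSet_Ioi] with t ht
  rw [norm_mul, norm_exp_neg_mul_ofReal, ← mul_assoc]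
  exact mul_le_mul_of_nonneg_right (hB κ hκ t ht) (Real.exp_pos _).le

/-- The Laplace transform of a symbol of order `β > -1` on `(0, ∞)` is `O(|z|^{-(β+1)})` in the
open right half-plane, uniformly up to the imaginary axis. -/
theorem norm_integral_le (h : SymbolFamily (Ioi 0) β n K f) (hK : β + 1 < K) (hβ : -1 < β) :
    ∃ A : ℝ, ∀ κ : ℝ, 0 < κ → ∀ z : ℂ, 0 < z.re →
      ‖∫ t in Ioi 0, f κ t * Complex.exp (-z * t)‖ ≤ A * κ ^ n * ‖z‖ ^ (-(β + 1)) := by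
  obtain ⟨A, hA⟩ := h.norm_integral_tail_le hK
  obtain ⟨B, hB⟩ := h.bound
  refine ⟨B / (β + 1) + A, fun κ hκ z hz => ?_⟩
  obtain ⟨K, rfl⟩ : ∃ k, K = k + 1 := Nat.exists_eq_succ_of_ne_zero (by rintro rfl; simp at hK; linarith)
  have hz0 : 0 < ‖z‖ := norm_pos_iff.2 fun h0 => by simp [h0] at hz
  have hr : 0 < ‖z‖⁻¹ := inv_pos.2 hz0
  have hint := h.integrableOn_mul_exp hβ hκ hz
  rw [← Ioc_union_Ioi_eq_Ioi hr.le, setIntegral_union (Ioc_disjoint_Ioi le_rfl) measurableSet_Ioi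
    (hint.mono_set Ioc_subset_Ioi_self) (hint.mono_set (Ioi_subset_Ioi hr.le))]
  refine (norm_add_le _ _).trans ?_
  rw [add_mul, add_mul]
  refine add_le_add ?_ (hA κ hκ z hz)
  have hI : IntegrableOn (fun t : ℝ => B * κ ^ n * t ^ β) (Ioc 0 ‖z‖⁻¹) :=
    ((intervalIntegral.intervalIntegrable_rpow' hβ (a := 0) (b := ‖z‖⁻¹)).1).const_mul _
  refine (norm_integral_le_of_norm_le hI ?_).trans (le_of_eq ?_)
  · filter_upwards [ae_restrict_mem measurableSet_Ioc] with t ht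
    rw [norm_mul, norm_exp_neg_mul_ofReal]
    refine (mul_le_of_le_one_right (norm_nonneg _) ?_).trans (hB κ hκ t ht.1)
    rw [Real.exp_le_one_iff]
    nlinarith [mul_pos hz ht.1]
  · rw [integral_const_mul, ← intervalIntegral.integral_of_le hr.le, integral_rpow (Or.inl hβ),
      Real.zero_rpow (by linarith), Real.inv_rpow hz0.le, ← Real.rpow_neg hz0.le]
    ring

end SymbolFamily

/-! ### Euler's integral along a ray and the decay of the Gamma function -/

theorem integrableOn_cpow_mul_exp_neg {s z : ℂ} (hs : 0 < s.re) (hz : 0 < z.re) :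
    IntegrableOn (fun t : ℝ => (t : ℂ) ^ (s - 1) * Complex.exp (-z * t)) (Ioi 0) := by
  have h : SymbolFamily (Ioi 0) (s - 1).re 0 1 (fun _ t => (t : ℂ) ^ (s - 1)) :=
    SymbolFamily.cpow isOpen_Ioi Subset.rfl _
  exact h.integrableOn_mul_exp (by simpa using hs) one_pos hz

theorem tendsto_cpow_mul_exp_neg_atTop (s : ℂ) {z : ℂ} (hz : 0 < z.re) :
    Tendsto (fun t : ℝ => (t : ℂ) ^ s * Complex.exp (-z * t)) atTop (𝓝 0) := by
  refine squeeze_zero_norm' ?_ (tendsto_rpow_mul_exp_neg_mul_atTop_nhds_zero s.re z.re hz)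
  filter_upwards [eventually_gt_atTop 0] with t ht
  rw [norm_mul, norm_exp_neg_mul_ofReal, Complex.norm_cpow_eq_rpow_re_of_pos ht]

theorem mul_integral_cpow_mul_exp_neg {s z : ℂ} (hs : 0 < s.re) (hz : 0 < z.re) :
    z * ∫ t in Ioi (0 : ℝ), (t : ℂ) ^ s * Complex.exp (-z * t) =
      s * ∫ t in Ioi (0 : ℝ), (t : ℂ) ^ (s - 1) * Complex.exp (-z * t) := by
  have hs0 : s ≠ 0 := fun h => by simp [h] at hs
  have h1 := integrableOn_cpow_mul_exp_neg hs hz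
  have h2 : IntegrableOn (fun t : ℝ => (t : ℂ) ^ s * Complex.exp (-z * t)) (Ioi 0) := by
    simpa using integrableOn_cpow_mul_exp_neg (s := s + 1) (by simp; linarith) hz
  have hd : ∀ t ∈ Ioi (0 : ℝ), HasDerivAt (fun t : ℝ => (t : ℂ) ^ s * Complex.exp (-z * t))
      (s * ((t : ℂ) ^ (s - 1) * Complex.exp (-z * t)) -
        z * ((t : ℂ) ^ s * Complex.exp (-z * t))) t := fun t ht => by
    refine ((hasDerivAt_ofReal_cpow_const (show 0 < t from ht).ne' hs0).mul
      (hasDerivAt_exp_neg_mul z t)).congr_deriv ?_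
    ring
  have hc : ContinuousWithinAt (fun t : ℝ => (t : ℂ) ^ s * Complex.exp (-z * t)) (Ici 0) 0 := by
    refine ContinuousAt.continuousWithinAt (ContinuousAt.mul ?_ (by fun_prop))
    exact Complex.continuousAt_ofReal_cpow_const 0 s (Or.inl hs)
  have := integral_Ioi_of_hasDerivAt_of_tendsto hc hd ((h1.const_mul s).sub (h2.const_mul z))
    (tendsto_cpow_mul_exp_neg_atTop s hz)
  rw [integral_sub (h1.const_mul s) (h2.const_mul z), integral_const_mul, integral_const_mul] at this
  simp only [Complex.ofReal_zero, Complex.zero_cpow hs0, zero_mul, sub_zero] at this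
  linear_combination -this

theorem hasDerivAt_integral_cpow_mul_exp_neg {s z : ℂ} (hs : 0 < s.re) (hz : 0 < z.re) :
    HasDerivAt (fun z : ℂ => ∫ t in Ioi (0 : ℝ), (t : ℂ) ^ (s - 1) * Complex.exp (-z * t))
      (-∫ t in Ioi (0 : ℝ), (t : ℂ) ^ s * Complex.exp (-z * t)) z := by
  have hz2 : 0 < ((z.re / 2 : ℝ) : ℂ).re := by simp [hz]
  have hint : IntegrableOn (fun t : ℝ => (t : ℂ) ^ s * Complex.exp (-((z.re / 2 : ℝ) : ℂ) * t))
      (Ioi 0) := by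
    simpa using integrableOn_cpow_mul_exp_neg (s := s + 1) (by simp; linarith) hz2
  have hs1 : {w : ℂ | z.re / 2 < w.re} ∈ 𝓝 z :=
    (isOpen_lt continuous_const Complex.continuous_re).mem_nhds (by simp; linarith)
  have hmeas : ∀ μ : ℂ, AEStronglyMeasurable (fun t : ℝ => (t : ℂ) ^ μ)
      (volume.restrict (Ioi (0 : ℝ))) := fun μ =>
    ContinuousOn.aestronglyMeasurable (fun t ht => (Complex.continuousAt_ofReal_cpow_const t μ
      (Or.inr (show 0 < t from ht).ne')).continuousWithinAt) measurableSet_Ioi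
  have key := (hasDerivAt_integral_of_dominated_loc_of_deriv_le (μ := volume.restrict (Ioi (0 : ℝ)))
    (F := fun (z : ℂ) (t : ℝ) => (t : ℂ) ^ (s - 1) * Complex.exp (-z * t))
    (F' := fun (z : ℂ) (t : ℝ) => -((t : ℂ) ^ s * Complex.exp (-z * t)))
    (bound := fun t => ‖(t : ℂ) ^ s * Complex.exp (-((z.re / 2 : ℝ) : ℂ) * t)‖)
    hs1 (Eventually.of_forall fun w => (hmeas _).mul (by fun_prop))
    (integrableOn_cpow_mul_exp_neg hs hz) ((hmeas _).mul (by fun_prop)).neg ?_ hint.norm ?_).2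
  · rwa [integral_neg] at key
  · filter_upwards [ae_restrict_mem measurableSet_Ioi] with t ht w hw
    rw [norm_neg, norm_mul, norm_mul, norm_exp_neg_mul_ofReal, norm_exp_neg_mul_ofReal]
    refine mul_le_mul_of_nonneg_left (Real.exp_le_exp.2 ?_) (norm_nonneg _)
    have ht' : 0 < t := ht
    have hw' : z.re / 2 < w.re := hw
    simp only [Complex.ofReal_re]
    nlinarith
  · filter_upwards [ae_restrict_mem measurableSet_Ioi] with t ht w _
    have ht0 : (t : ℂ) ≠ 0 := by exact_mod_cast (show 0 < t from ht).ne'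
    have h1 : HasDerivAt (fun w : ℂ => -w * (t : ℂ)) (-(t : ℂ)) w := by
      simpa using (hasDerivAt_id w).neg.mul_const (t : ℂ)
    refine (h1.cexp.const_mul ((t : ℂ) ^ (s - 1))).congr_deriv ?_
    rw [Complex.cpow_sub _ _ ht0, Complex.cpow_one]
    field_simp

/-- Euler's integral along a rotated ray. -/
theorem integral_cpow_mul_exp_neg_mul_Ioi_of_re_pos {s z : ℂ} (hs : 0 < s.re) (hz : 0 < z.re) :
    ∫ t in Ioi (0 : ℝ), (t : ℂ) ^ (s - 1) * Complex.exp (-z * t) =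
      z ^ (-s) * Complex.Gamma s := by
  set I : ℂ → ℂ := fun z => ∫ t in Ioi (0 : ℝ), (t : ℂ) ^ (s - 1) * Complex.exp (-z * t) with hI
  have hopen : IsOpen {w : ℂ | 0 < w.re} := isOpen_lt continuous_const Complex.continuous_re
  have hconn : IsPreconnected {w : ℂ | 0 < w.re} := (convex_halfSpace_re_gt 0).isPreconnected
  have hd : ∀ w : ℂ, 0 < w.re → HasDerivAt (fun w : ℂ => w ^ s * I w) 0 w := fun w hw => by
    have hw0 : w ≠ 0 := fun h => by simp [h] at hw
    refine (((hasDerivAt_id w).cpow_const (c := s) (Or.inl hw)).mul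
      (hasDerivAt_integral_cpow_mul_exp_neg hs hw)).congr_deriv ?_
    have := mul_integral_cpow_mul_exp_neg hs hw
    simp only [id, neg_mul] at this ⊢
    rw [Complex.cpow_sub _ _ hw0, Complex.cpow_one]
    field_simp
    linear_combination -w ^ s * this
  have hconst := hopen.is_const_of_deriv_eq_zero hconn
    (fun w hw => (hd w hw).differentiableAt.differentiableWithinAt)
    (fun w hw => (hd w hw).deriv) (show z ∈ {w : ℂ | 0 < w.re} from hz)
    (show (1 : ℂ) ∈ {w : ℂ | 0 < w.re} by simp)
  have h1 : I 1 = Complex.Gamma s := by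
    rw [Complex.Gamma_eq_integral hs, Complex.GammaIntegral, hI]
    refine setIntegral_congr_fun measurableSet_Ioi fun t _ => ?_
    simp [mul_comm]
  simp only [Complex.one_cpow, one_mul, h1] at hconst
  have hz0 : z ≠ 0 := fun h => by simp [h] at hz
  rw [← hconst, Complex.cpow_neg, inv_mul_cancel_left₀]
  simp [Complex.cpow_eq_zero_iff, hz0]

/-- Stirling-type decay of `Γ` on vertical lines, with a non-optimal power of `|Im s|`. -/
theorem norm_Gamma_mul_exp_le {s : ℂ} (hs : 0 < s.re) :
    ‖Complex.Gamma s‖ * Real.exp (Real.pi / 2 * |s.im|) ≤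
      Real.exp 1 * Real.Gamma s.re * (Real.pi / 2 * (1 + |s.im|)) ^ s.re := by
  set δ : ℝ := 1 / (1 + |s.im|) with hδ
  have h1 : 0 < 1 + |s.im| := by positivity
  have hδ0 : 0 < δ := by positivity
  have hδ1 : δ ≤ 1 := by rw [hδ, div_le_one h1]; linarith [abs_nonneg s.im]
  have hpi := Real.pi_gt_three
  -- the ray of angle `θ`, at distance `δ` from the imaginary axis
  have key : ∀ θ : ℝ, |θ| = Real.pi / 2 - δ →
      ‖Complex.Gamma s‖ * Real.exp (θ * s.im) ≤
        Real.Gamma s.re * (Real.pi / 2 * (1 + |s.im|)) ^ s.re := by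
    intro θ hθ
    have hcos : 2 / Real.pi * δ ≤ Real.cos θ := by
      rw [← Real.cos_abs, hθ, Real.cos_pi_div_two_sub]
      exact Real.mul_le_sin hδ0.le (by linarith)
    have hc0 : 0 < Real.cos θ := lt_of_lt_of_le (by positivity) hcos
    set z : ℂ := Complex.exp (θ * Complex.I) with hz
    have hzre : z.re = Real.cos θ := by rw [hz, Complex.exp_ofReal_mul_I_re]
    have hz0 : 0 < z.re := hzre ▸ hc0
    have hlog : Complex.log z = θ * Complex.I := by
      rw [hz, Complex.log_exp]
      · simp; have := neg_abs_le θ; linarith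
      · simp; have := le_abs_self θ; linarith
    have hnorm : ‖z ^ (-s)‖ = Real.exp (θ * s.im) := by
      rw [Complex.cpow_def_of_ne_zero (Complex.exp_ne_zero _), hlog, Complex.norm_exp]
      simp
    have hbound : ‖z ^ (-s) * Complex.Gamma s‖ ≤
        ∫ t in Ioi (0 : ℝ), t ^ (s.re - 1) * Real.exp (-(Real.cos θ * t)) := by
      rw [← integral_cpow_mul_exp_neg_mul_Ioi_of_re_pos hs hz0]
      refine (norm_integral_le_integral_norm _).trans (le_of_eq ?_)
      refine setIntegral_congr_fun measurableSet_Ioi fun t ht => ?_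
      rw [norm_mul, norm_exp_neg_mul_ofReal, Complex.norm_cpow_eq_rpow_re_of_pos ht, hzre]
      simp
    rw [Real.integral_rpow_mul_exp_neg_mul_Ioi hs hc0, norm_mul, hnorm] at hbound
    rw [mul_comm (Real.Gamma _), mul_comm ‖_‖]
    refine hbound.trans ?_
    refine mul_le_mul_of_nonneg_right ?_ (Real.Gamma_pos_of_pos hs).le
    refine Real.rpow_le_rpow (by positivity) ?_ hs.le
    rw [div_le_iff₀ hc0]
    calc 1 = Real.pi / 2 * (1 + |s.im|) * (2 / Real.pi * δ) := by rw [hδ]; field_simp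
      _ ≤ _ := by gcongr
  have hfin : ∀ θ : ℝ, |θ| = Real.pi / 2 - δ → θ * s.im = (Real.pi / 2 - δ) * |s.im| →
      ‖Complex.Gamma s‖ * Real.exp (Real.pi / 2 * |s.im|) ≤
        Real.exp 1 * Real.Gamma s.re * (Real.pi / 2 * (1 + |s.im|)) ^ s.re := by
    intro θ hθ hθs
    have h2 : Real.exp (Real.pi / 2 * |s.im|) ≤ Real.exp 1 * Real.exp (θ * s.im) := by
      rw [← Real.exp_add, Real.exp_le_exp, hθs]
      have : δ * |s.im| ≤ 1 := by
        rw [hδ, one_div, inv_mul_le_iff₀ h1]; linarith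
      linarith
    calc ‖Complex.Gamma s‖ * Real.exp (Real.pi / 2 * |s.im|)
        ≤ ‖Complex.Gamma s‖ * (Real.exp 1 * Real.exp (θ * s.im)) := by gcongr
      _ = Real.exp 1 * (‖Complex.Gamma s‖ * Real.exp (θ * s.im)) := by ring
      _ ≤ Real.exp 1 * (Real.Gamma s.re * (Real.pi / 2 * (1 + |s.im|)) ^ s.re) := by
          exact mul_le_mul_of_nonneg_left (key θ hθ) (Real.exp_pos 1).le
      _ = _ := by ring
  have h3 : 0 ≤ Real.pi / 2 - δ := by linarith
  rcases le_total 0 s.im with h | h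
  · exact hfin (Real.pi / 2 - δ) (abs_of_nonneg h3) (by rw [abs_of_nonneg h])
  · exact hfin (-(Real.pi / 2 - δ)) (by rw [abs_neg, abs_of_nonneg h3])
      (by rw [abs_of_nonpos h]; ring)

/-! ### Mellin transforms of Schwartz functions on the half-line -/

/-- Continuous functions on `(0, ∞)`, bounded near `0` and rapidly decreasing at infinity. -/
def RapidDecayOnPos (f : ℝ → ℂ) : Prop :=
  ContinuousOn f (Ioi 0) ∧ ∀ ν : ℝ, 0 ≤ ν → ∃ B : ℝ, ∀ y : ℝ, 0 < y → ‖f y‖ ≤ B * y ^ (-ν)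

namespace RapidDecayOnPos

variable {f g : ℝ → ℂ}

theorem isBigO_top (hf : RapidDecayOnPos f) {ν : ℝ} (hν : 0 ≤ ν) :
    f =O[atTop] fun y : ℝ => y ^ (-ν) := by
  obtain ⟨B, hB⟩ := hf.2 ν hν
  refine Asymptotics.IsBigO.of_bound B ?_
  filter_upwards [eventually_gt_atTop 0] with y hy
  rw [Real.norm_of_nonneg (Real.rpow_nonneg hy.le _)]
  exact hB y hy

theorem isBigO_zero (hf : RapidDecayOnPos f) : f =O[𝓝[>] 0] fun y : ℝ => y ^ (-(0 : ℝ)) := by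
  obtain ⟨B, hB⟩ := hf.2 0 le_rfl
  refine Asymptotics.IsBigO.of_bound B ?_
  filter_upwards [self_mem_nhdsWithin] with y hy
  rw [Real.norm_of_nonneg (Real.rpow_nonneg (le_of_lt hy) _)]
  exact hB y hy

theorem mellinConvergent (hf : RapidDecayOnPos f) {s : ℂ} (hs : 0 < s.re) :
    MellinConvergent f s :=
  mellinConvergent_of_isBigO_rpow (hf.1.locallyIntegrableOn measurableSet_Ioi)
    (hf.isBigO_top (by linarith : 0 ≤ s.re + 1)) (lt_add_one _) hf.isBigO_zero hs

theorem continuous_mellin (hf : RapidDecayOnPos f) {τ : ℝ} (hτ : 0 < τ) :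
    Continuous fun t : ℝ => mellin f (τ + t * Complex.I) := by
  refine continuous_iff_continuousAt.2 fun t => ?_
  have h1 : DifferentiableAt ℂ (mellin f) (τ + t * Complex.I) :=
    mellin_differentiableAt_of_isBigO_rpow (a := τ + 1) (b := 0)
      (hf.1.locallyIntegrableOn measurableSet_Ioi)
      (hf.isBigO_top (by linarith)) (by simp) hf.isBigO_zero (by simpa)
  exact h1.continuousAt.comp (f := fun t : ℝ => (τ : ℂ) + t * Complex.I) (by fun_prop)

theorem exists_norm_mellin_le (f : ℝ → ℂ) (τ : ℝ) :
    ∃ A : ℝ, ∀ t : ℝ, ‖mellin f (τ + t * Complex.I)‖ ≤ A := by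
  refine ⟨∫ y in Ioi (0 : ℝ), ‖(y : ℂ) ^ ((τ : ℂ) - 1) • f y‖, fun t => ?_⟩
  refine (norm_integral_le_integral_norm _).trans (le_of_eq ?_)
  refine setIntegral_congr_fun measurableSet_Ioi fun y hy => ?_
  rw [norm_smul, norm_smul, Complex.norm_cpow_eq_rpow_re_of_pos hy,
    Complex.norm_cpow_eq_rpow_re_of_pos hy]
  simp

/-- The Mellin transform turns the Euler operator `y d/dy` into multiplication by `-s`. -/
theorem mellin_euler (hf : RapidDecayOnPos f) (hg : RapidDecayOnPos g)
    (hd : ∀ y : ℝ, 0 < y → HasDerivAt f (g y / y) y) {s : ℂ} (hs : 0 < s.re) :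
    mellin g s = -s * mellin f s := by
  have hs0 : s ≠ 0 := fun h => by simp [h] at hs
  have h1 := hf.mellinConvergent hs
  have h2 := hg.mellinConvergent hs
  have hderiv : ∀ y ∈ Ioi (0 : ℝ), HasDerivAt (fun y : ℝ => (y : ℂ) ^ s * f y)
      (s * ((y : ℂ) ^ (s - 1) • f y) + (y : ℂ) ^ (s - 1) • g y) y := fun y hy => by
    have hy0 : (y : ℂ) ≠ 0 := by exact_mod_cast (show 0 < y from hy).ne'
    refine ((hasDerivAt_ofReal_cpow_const (show 0 < y from hy).ne' hs0).mul
      (hd y hy)).congr_deriv ?_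
    simp only [smul_eq_mul]
    rw [Complex.cpow_sub _ _ hy0, Complex.cpow_one]
    field_simp
  have hnorm : ∀ y : ℝ, 0 < y → ‖(y : ℂ) ^ s * f y‖ = y ^ s.re * ‖f y‖ := fun y hy => by
    rw [norm_mul, Complex.norm_cpow_eq_rpow_re_of_pos hy]
  have hc : ContinuousWithinAt (fun y : ℝ => (y : ℂ) ^ s * f y) (Ici 0) 0 := by
    obtain ⟨B, hB⟩ := hf.2 0 le_rfl
    rw [← continuousWithinAt_Ioi_iff_Ici, ContinuousWithinAt]
    have hlim : Tendsto (fun y : ℝ => y ^ s.re * B) (𝓝[>] 0) (𝓝 0) := by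
      have : ContinuousAt (fun y : ℝ => y ^ s.re * B) 0 :=
        (Real.continuousAt_rpow_const 0 s.re (Or.inr hs.le)).mul continuousAt_const
      have h3 := this.tendsto.mono_left (nhdsWithin_le_nhds (s := Ioi 0))
      simpa [Real.zero_rpow hs.ne'] using h3
    simp only [Complex.ofReal_zero, Complex.zero_cpow hs0, zero_mul]
    refine squeeze_zero_norm' ?_ hlim
    filter_upwards [self_mem_nhdsWithin] with y hy
    have hy' : 0 < y := hy
    rw [hnorm y hy']
    refine mul_le_mul_of_nonneg_left ?_ (Real.rpow_nonneg hy'.le _)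
    simpa using hB y hy'
  have htop : Tendsto (fun y : ℝ => (y : ℂ) ^ s * f y) atTop (𝓝 0) := by
    obtain ⟨B, hB⟩ := hf.2 (s.re + 1) (by linarith)
    have hlim : Tendsto (fun y : ℝ => B * y⁻¹) atTop (𝓝 0) := by
      simpa using tendsto_inv_atTop_zero.const_mul B
    refine squeeze_zero_norm' ?_ hlim
    filter_upwards [eventually_gt_atTop 0] with y hy
    rw [hnorm y hy]
    calc y ^ s.re * ‖f y‖ ≤ y ^ s.re * (B * y ^ (-(s.re + 1))) :=
          mul_le_mul_of_nonneg_left (hB y hy) (Real.rpow_nonneg hy.le _)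
      _ = B * (y ^ s.re * y ^ (-(s.re + 1))) := by ring
      _ = B * y⁻¹ := by
        rw [← Real.rpow_add hy, show s.re + -(s.re + 1) = -1 by ring, Real.rpow_neg_one]
  have h4 := integral_Ioi_of_hasDerivAt_of_tendsto hc hderiv ((h1.const_mul s).add h2) htop
  rw [integral_add (h1.const_mul s) h2, integral_const_mul] at h4
  simp only [Complex.ofReal_zero, Complex.zero_cpow hs0, zero_mul, sub_zero] at h4
  simp only [mellin]
  linear_combination h4

end RapidDecayOnPos

/-- Linear combinations of the functions `y^j φ^{(j)}(y)` on `(0, ∞)`. -/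
def IsEulerCombination (φ f : ℝ → ℂ) : Prop :=
  ∃ (N : ℕ) (b : ℕ → ℂ), ∀ y : ℝ, 0 < y →
    f y = ∑ j ∈ Finset.range N, b j * ((y : ℂ) ^ j * iteratedDeriv j φ y)

/-- The sequence `j! · binom(-(y/2) d/dy, j) φ`, so that the Mellin transform of the `j`-th term is
`j! · binom(u/2, j)` times that of `φ`. -/
noncomputable def eulerFalling (φ : ℝ → ℂ) : ℕ → ℝ → ℂ
  | 0 => φ
  | j + 1 => fun y => -(y / 2) * deriv (eulerFalling φ j) y - j * eulerFalling φ j y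

namespace IsSchwartzOnPos

variable {φ f g : ℝ → ℂ}

theorem hasDerivAt_iteratedDeriv (hφ : IsSchwartzOnPos φ) (j : ℕ) {y : ℝ} (hy : 0 < y) :
    HasDerivAt (iteratedDeriv j φ) (iteratedDeriv (j + 1) φ y) y := by
  have h1 : DifferentiableOn ℝ (iteratedDerivWithin j φ (Ioi 0)) (Ioi 0) :=
    hφ.1.differentiableOn_iteratedDerivWithin (by exact_mod_cast WithTop.coe_lt_top _)
      isOpen_Ioi.uniqueDiffOn
  have h2 : DifferentiableAt ℝ (iteratedDeriv j φ) y := by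
    refine (h1.differentiableAt (Ioi_mem_nhds hy)).congr_of_eventuallyEq ?_
    filter_upwards [Ioi_mem_nhds hy] with x hx
    exact (iteratedDerivWithin_of_isOpen isOpen_Ioi hx).symm
  rw [iteratedDeriv_succ]
  exact h2.hasDerivAt

theorem isEulerCombination_monomial (b : ℂ) (j : ℕ) :
    IsEulerCombination φ fun y => b * ((y : ℂ) ^ j * iteratedDeriv j φ y) := by
  refine ⟨j + 1, fun i => if i = j then b else 0, fun y _ => ?_⟩
  rw [Finset.sum_eq_single j] <;> simp +contextual

theorem isEulerCombination_add (hf : IsEulerCombination φ f) (hg : IsEulerCombination φ g) :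
    IsEulerCombination φ fun y => f y + g y := by
  obtain ⟨N, b, hb⟩ := hf
  obtain ⟨N', b', hb'⟩ := hg
  refine ⟨N + N', fun j => (if j < N then b j else 0) + (if j < N' then b' j else 0),
    fun y hy => ?_⟩
  have hext : ∀ (n m : ℕ) (c T : ℕ → ℂ), n ≤ m → ∑ j ∈ Finset.range n, c j * T j =
      ∑ j ∈ Finset.range m, (if j < n then c j else 0) * T j := by
    intro n m c T hnm
    rw [← Finset.sum_subset (Finset.range_mono hnm)]
    · exact Finset.sum_congr rfl fun j hj => by rw [if_pos (Finset.mem_range.1 hj)]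
    · intro j _ hj
      rw [if_neg (by simpa using hj), zero_mul]
  beta_reduce
  rw [hb y hy, hb' y hy, hext N (N + N') b _ (by omega), hext N' (N + N') b' _ (by omega),
    ← Finset.sum_add_distrib]
  exact Finset.sum_congr rfl fun j _ => by ring

theorem isEulerCombination_sum {ι : Type*} (s : Finset ι) {F : ι → ℝ → ℂ}
    (hF : ∀ i ∈ s, IsEulerCombination φ (F i)) :
    IsEulerCombination φ fun y => ∑ i ∈ s, F i y := by
  classical
  induction s using Finset.induction_on with
  | empty => exact ⟨0, 0, fun y _ => by simp⟩
  | insert i s hi ih =>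
    simp only [Finset.sum_insert hi]
    exact isEulerCombination_add (hF i (Finset.mem_insert_self i s))
      (ih fun j hj => hF j (Finset.mem_insert_of_mem hj))

theorem hasDerivAt_eulerCombination (hφ : IsSchwartzOnPos φ) {N : ℕ} {b : ℕ → ℂ}
    (hf : ∀ y : ℝ, 0 < y →
      f y = ∑ j ∈ Finset.range N, b j * ((y : ℂ) ^ j * iteratedDeriv j φ y))
    {y : ℝ} (hy : 0 < y) :
    HasDerivAt f (∑ j ∈ Finset.range N, b j * (((j : ℂ) * (y : ℂ) ^ (j - 1)) * iteratedDeriv j φ y +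
      (y : ℂ) ^ j * iteratedDeriv (j + 1) φ y)) y := by
  have h1 : HasDerivAt (fun y : ℝ => ∑ j ∈ Finset.range N,
      b j * ((y : ℂ) ^ j * iteratedDeriv j φ y)) (∑ j ∈ Finset.range N,
      b j * (((j : ℂ) * (y : ℂ) ^ (j - 1)) * iteratedDeriv j φ y +
      (y : ℂ) ^ j * iteratedDeriv (j + 1) φ y)) y := by
    refine HasDerivAt.fun_sum fun j _ => HasDerivAt.const_mul _ (HasDerivAt.mul ?_ ?_)
    · exact (hasDerivAt_pow j (y : ℂ)).comp_ofReal
    · exact hφ.hasDerivAt_iteratedDeriv j hy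
  refine h1.congr_of_eventuallyEq ?_
  filter_upwards [Ioi_mem_nhds hy] with x hx using hf x hx

theorem isEulerCombination_eulerFalling (hφ : IsSchwartzOnPos φ) (j : ℕ) :
    IsEulerCombination φ (eulerFalling φ j) := by
  induction j with
  | zero => exact ⟨1, fun _ => 1, fun y _ => by simp [eulerFalling]⟩
  | succ j ih =>
    obtain ⟨N, b, hb⟩ := ih
    have h1 : IsEulerCombination φ fun y => ∑ i ∈ Finset.range N,
        ((-(i / 2 : ℂ) - j) * b i * ((y : ℂ) ^ i * iteratedDeriv i φ y) +
          -(1 / 2) * b i * ((y : ℂ) ^ (i + 1) * iteratedDeriv (i + 1) φ y)) :=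
      isEulerCombination_sum _ fun i _ => isEulerCombination_add
        (isEulerCombination_monomial _ _) (isEulerCombination_monomial _ _)
    obtain ⟨N', b', hb'⟩ := h1
    refine ⟨N', b', fun y hy => ?_⟩
    rw [← hb' y hy, eulerFalling]
    beta_reduce
    rw [(hφ.hasDerivAt_eulerCombination hb hy).deriv, hb y hy,
      Finset.mul_sum, Finset.mul_sum, ← Finset.sum_sub_distrib]
    refine Finset.sum_congr rfl fun i _ => ?_
    rcases i with _ | i
    · simp; ring
    · simp only [Nat.add_sub_cancel]
      push_cast
      ring

theorem differentiableAt_eulerFalling (hφ : IsSchwartzOnPos φ) (j : ℕ) {y : ℝ} (hy : 0 < y) :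
    DifferentiableAt ℝ (eulerFalling φ j) y := by
  obtain ⟨N, b, hb⟩ := hφ.isEulerCombination_eulerFalling j
  exact (hφ.hasDerivAt_eulerCombination hb hy).differentiableAt

theorem hasDerivAt_eulerFalling (hφ : IsSchwartzOnPos φ) (j : ℕ) {y : ℝ} (hy : 0 < y) :
    HasDerivAt (eulerFalling φ j)
      (-2 * (eulerFalling φ (j + 1) y + j * eulerFalling φ j y) / y) y := by
  refine (hφ.differentiableAt_eulerFalling j hy).hasDerivAt.congr_deriv ?_
  have hy0 : (y : ℂ) ≠ 0 := by exact_mod_cast hy.ne'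
  rw [eulerFalling]
  field_simp
  ring

theorem rapidDecayOnPos_eulerFalling (hφ : IsSchwartzOnPos φ) (j : ℕ) :
    RapidDecayOnPos (eulerFalling φ j) := by
  refine ⟨fun y hy => (hφ.differentiableAt_eulerFalling j hy).continuousAt.continuousWithinAt,
    fun ν hν => ?_⟩
  obtain ⟨N, b, hb⟩ := hφ.isEulerCombination_eulerFalling j
  have hnat : ∀ n : ℕ, ∃ B : ℝ, ∀ y : ℝ, 0 < y → y ^ n * ‖eulerFalling φ j y‖ ≤ B := by
    intro n
    choose B hB using fun i => hφ.2 (n + i) i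
    refine ⟨∑ i ∈ Finset.range N, ‖b i‖ * B i, fun y hy => ?_⟩
    rw [hb y hy]
    calc y ^ n * ‖∑ i ∈ Finset.range N, b i * ((y : ℂ) ^ i * iteratedDeriv i φ y)‖
        ≤ y ^ n * ∑ i ∈ Finset.range N, ‖b i * ((y : ℂ) ^ i * iteratedDeriv i φ y)‖ := by
          gcongr; exact norm_sum_le _ _
      _ = ∑ i ∈ Finset.range N, ‖b i‖ * (y ^ (n + i) * ‖iteratedDeriv i φ y‖) := by
          rw [Finset.mul_sum]
          refine Finset.sum_congr rfl fun i _ => ?_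
          rw [norm_mul, norm_mul, norm_pow, Complex.norm_real, Real.norm_of_nonneg hy.le, pow_add]
          ring
      _ ≤ _ := by gcongr with i _; exact hB i y hy
  obtain ⟨B₀, hB₀⟩ := hnat 0
  obtain ⟨B₁, hB₁⟩ := hnat ⌈ν⌉₊
  refine ⟨max B₀ B₁, fun y hy => ?_⟩
  rw [Real.rpow_neg hy.le, ← div_eq_mul_inv, le_div_iff₀ (Real.rpow_pos_of_pos hy _), mul_comm]
  rcases le_total y 1 with h | h
  · refine le_trans ?_ ((hB₀ y hy).trans (le_max_left _ _))
    simpa using mul_le_of_le_one_left (norm_nonneg (eulerFalling φ j y))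
      (Real.rpow_le_one hy.le h hν)
  · refine le_trans ?_ ((hB₁ y hy).trans (le_max_right _ _))
    refine mul_le_mul_of_nonneg_right ?_ (norm_nonneg _)
    rw [← Real.rpow_natCast]
    exact Real.rpow_le_rpow_of_exponent_le h (Nat.le_ceil ν)

theorem mellin_eulerFalling_succ (hφ : IsSchwartzOnPos φ) (j : ℕ) {s : ℂ} (hs : 0 < s.re) :
    mellin (eulerFalling φ (j + 1)) s = (s / 2 - j) * mellin (eulerFalling φ j) s := by
  have h0 := hφ.rapidDecayOnPos_eulerFalling j
  have h1 := hφ.rapidDecayOnPos_eulerFalling (j + 1)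
  have h2 : RapidDecayOnPos fun y => -2 * (eulerFalling φ (j + 1) y + j * eulerFalling φ j y) := by
    refine ⟨continuousOn_const.mul (h1.1.add (continuousOn_const.mul h0.1)), fun ν hν => ?_⟩
    obtain ⟨B, hB⟩ := h0.2 ν hν
    obtain ⟨B', hB'⟩ := h1.2 ν hν
    refine ⟨2 * (B' + j * B), fun y hy => ?_⟩
    rw [norm_mul, norm_neg, Complex.norm_ofNat, mul_assoc, add_mul, mul_assoc]
    refine mul_le_mul_of_nonneg_left ((norm_add_le _ _).trans (add_le_add (hB' y hy) ?_))
      zero_le_two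
    rw [norm_mul, Complex.norm_natCast]
    exact mul_le_mul_of_nonneg_left (hB y hy) (Nat.cast_nonneg j)
  have h3 := h0.mellin_euler h2 (fun y hy => hφ.hasDerivAt_eulerFalling j hy) hs
  have h4 : mellin (fun y => -2 * (eulerFalling φ (j + 1) y + j * eulerFalling φ j y)) s =
      -2 * (mellin (eulerFalling φ (j + 1)) s + j * mellin (eulerFalling φ j) s) := by
    simp only [mellin]
    rw [← integral_const_mul, ← integral_add (h1.mellinConvergent hs)
      ((h0.mellinConvergent hs).const_mul _), ← integral_const_mul]
    refine setIntegral_congr_fun measurableSet_Ioi fun y _ => ?_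
    simp only [smul_eq_mul]
    ring
  rw [h4] at h3
  linear_combination (-1 / 2) * h3

theorem mellin_eulerFalling (hφ : IsSchwartzOnPos φ) (j : ℕ) {s : ℂ} (hs : 0 < s.re) :
    mellin (eulerFalling φ j) s = j.factorial * Ring.choose (s / 2) j * mellin φ s := by
  have h : ∀ j : ℕ, mellin (eulerFalling φ j) s =
      (descPochhammer ℂ j).eval (s / 2) * mellin φ s := by
    intro j
    induction j with
    | zero => simp [eulerFalling]
    | succ j ih =>
      rw [hφ.mellin_eulerFalling_succ j hs, ih, descPochhammer_succ_right]
      simp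
      ring
  have h2 := Ring.descPochhammer_eq_factorial_smul_choose (s / 2) j
  rw [← Polynomial.aeval_eq_smeval, Polynomial.aeval_def, ← Polynomial.eval_map,
    descPochhammer_map, nsmul_eq_mul] at h2
  rw [h j, h2]

/-- Rapid decay of the Mellin transforms on vertical lines. -/
theorem norm_mellin_eulerFalling_le (hφ : IsSchwartzOnPos φ) {τ : ℝ} (hτ : 0 < τ) (N j : ℕ) :
    ∃ A : ℝ, ∀ t : ℝ,
      (1 + |t|) ^ N * ‖mellin (eulerFalling φ j) (τ + t * Complex.I)‖ ≤ A := by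
  induction N generalizing j with
  | zero =>
    obtain ⟨A, hA⟩ := RapidDecayOnPos.exists_norm_mellin_le (eulerFalling φ j) τ
    exact ⟨A, fun t => by simpa using hA t⟩
  | succ N ih =>
    obtain ⟨A, hA⟩ := ih j
    obtain ⟨A', hA'⟩ := ih (j + 1)
    refine ⟨A + 2 * A', fun t => ?_⟩
    set m := ‖mellin (eulerFalling φ j) (τ + t * Complex.I)‖ with hm
    have h1 : |t| / 2 * m ≤ ‖mellin (eulerFalling φ (j + 1)) (τ + t * Complex.I)‖ := by
      rw [hφ.mellin_eulerFalling_succ j (by simpa using hτ), norm_mul]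
      refine mul_le_mul_of_nonneg_right ?_ (norm_nonneg _)
      refine le_trans (le_of_eq ?_) (Complex.abs_im_le_norm _)
      simp [abs_div]
    calc (1 + |t|) ^ (N + 1) * m = (1 + |t|) ^ N * m + 2 * ((1 + |t|) ^ N * (|t| / 2 * m)) := by
          ring
      _ ≤ A + 2 * A' := by
          gcongr
          · exact hA t
          · exact le_trans (by gcongr) (hA' t)

theorem mellin_inversion_eulerFalling (hφ : IsSchwartzOnPos φ) {τ : ℝ} (hτ : 0 < τ) (j : ℕ) {y : ℝ}
    (hy : 0 < y) :
    1 / (2 * Real.pi) * ∫ t : ℝ, (y : ℂ) ^ (-(τ + t * Complex.I)) *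
      mellin (eulerFalling φ j) (τ + t * Complex.I) = eulerFalling φ j y := by
  have h0 := hφ.rapidDecayOnPos_eulerFalling j
  have hv : Complex.VerticalIntegrable (mellin (eulerFalling φ j)) τ := by
    obtain ⟨A, hA⟩ := hφ.norm_mellin_eulerFalling_le hτ 2 j
    refine Integrable.mono' ((integrable_inv_one_add_sq).const_mul A)
      (h0.continuous_mellin hτ).aestronglyMeasurable (Eventually.of_forall fun t => ?_)
    rw [← div_eq_mul_inv, le_div_iff₀ (by positivity), mul_comm]
    refine le_trans (mul_le_mul_of_nonneg_right ?_ (norm_nonneg _)) (hA t)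
    nlinarith [abs_nonneg t, sq_abs t]
  have := mellinInv_mellin_eq τ (eulerFalling φ j) hy (h0.mellinConvergent (by simpa using hτ)) hv
    (hφ.differentiableAt_eulerFalling j hy).continuousAt
  rw [← this, mellinInv]
  simp [Complex.real_smul]

end IsSchwartzOnPos

/-! ### Taylor remainders as symbols -/

/-- The Taylor remainder `F_i(t) - ∑_{j < N} t^j / j! · F_{i+j}(0)` of a sequence of functions,
each of which is the derivative of the preceding one. -/
noncomputable def taylorRemainder (F : ℕ → ℝ → ℂ) (N i : ℕ) (t : ℝ) : ℂ :=
  F i t - ∑ j ∈ Finset.range N, (t : ℂ) ^ j / j.factorial * F (i + j) 0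

theorem hasDerivWithinAt_taylorRemainder {F : ℕ → ℝ → ℂ} {s : Set ℝ}
    (hF : ∀ i, ∀ t ∈ s, HasDerivWithinAt (F i) (F (i + 1) t) s t) (N i : ℕ) {t : ℝ} (ht : t ∈ s) :
    HasDerivWithinAt (taylorRemainder F N i) (taylorRemainder F (N - 1) (i + 1) t) s t := by
  have h1 : HasDerivWithinAt (fun t : ℝ => ∑ j ∈ Finset.range N,
      (t : ℂ) ^ j / j.factorial * F (i + j) 0) (∑ j ∈ Finset.range N,
      (j * (t : ℂ) ^ (j - 1)) / j.factorial * F (i + j) 0) s t :=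
    HasDerivWithinAt.fun_sum fun j _ => (((hasDerivAt_pow j (t : ℂ)).comp_ofReal.div_const
      _).mul_const _).hasDerivWithinAt
  refine ((hF i t ht).sub h1).congr_deriv ?_
  rw [taylorRemainder]
  congr 1
  rcases N with _ | N
  · simp
  · rw [Finset.sum_range_succ', Nat.add_sub_cancel]
    simp only [Nat.cast_zero, zero_mul, zero_div, add_zero]
    refine Finset.sum_congr rfl fun j _ => ?_
    have : (j.factorial : ℂ) ≠ 0 := by exact_mod_cast j.factorial_ne_zero
    rw [Nat.add_sub_cancel, Nat.factorial_succ, add_right_comm i 1 j, add_assoc i j 1]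
    push_cast
    have h2 : (j : ℂ) + 1 ≠ 0 := by exact_mod_cast j.succ_ne_zero
    field_simp

theorem norm_taylorRemainder_le {F : ℕ → ℝ → ℂ} {T B : ℝ}
    (hF : ∀ i, ∀ t ∈ Icc 0 T, HasDerivWithinAt (F i) (F (i + 1) t) (Icc 0 T) t) (N i : ℕ)
    (hB : ∀ t ∈ Icc 0 T, ‖F (i + N) t‖ ≤ B) {t : ℝ} (ht : t ∈ Icc 0 T) :
    ‖taylorRemainder F N i t‖ ≤ B * t ^ N := by
  induction N generalizing i t with
  | zero => simpa [taylorRemainder] using hB t ht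
  | succ N ih =>
    have hB0 : 0 ≤ B := (norm_nonneg _).trans (hB t ht)
    have hsub : Icc 0 t ⊆ Icc 0 T := Icc_subset_Icc_right ht.2
    have h0 : taylorRemainder F (N + 1) i 0 = 0 := by
      rw [taylorRemainder, Finset.sum_range_succ']
      simp
    have h1 := Convex.norm_image_sub_le_of_norm_hasDerivWithin_le (s := Icc 0 t) (x := 0) (y := t)
      (f := taylorRemainder F (N + 1) i) (f' := taylorRemainder F N (i + 1)) (C := B * t ^ N)
      (fun x hx => (hasDerivWithinAt_taylorRemainder hF (N + 1) i (hsub hx)).mono hsub)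
      (fun x hx => by
        refine (ih (i + 1) (fun y hy => ?_) (hsub hx)).trans ?_
        · rw [add_assoc, add_comm 1 N]
          exact hB y hy
        · have := hx.1
          have := hx.2
          gcongr)
      (convex_Icc 0 t) (left_mem_Icc.2 ht.1) (right_mem_Icc.2 ht.1)
    rw [h0, sub_zero, sub_zero, Real.norm_of_nonneg ht.1] at h1
    rw [pow_succ, ← mul_assoc]
    exact h1

/-- Taylor remainders of a smooth function are symbols, of order the length of the Taylor
polynomial: the Euler operator maps remainders to remainders. -/
theorem symbolFamily_taylorRemainder {F : ℕ → ℝ → ℂ} {T : ℝ}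
    (hF : ∀ i, ∀ t ∈ Icc 0 T, HasDerivWithinAt (F i) (F (i + 1) t) (Icc 0 T) t) (N i K : ℕ) :
    SymbolFamily (Ioo 0 T) N 0 K (fun _ t => taylorRemainder F N i t) := by
  have hbound : ∀ N i, ∃ B : ℝ, ∀ κ : ℝ, 0 < κ → ∀ t ∈ Ioo 0 T,
      ‖taylorRemainder F N i t‖ ≤ B * κ ^ (0 : ℝ) * t ^ (N : ℝ) := by
    intro N i
    have hcont : ContinuousOn (F (i + N)) (Icc 0 T) := fun t ht => (hF _ t ht).continuousWithinAt
    obtain ⟨B, hB⟩ := isCompact_Icc.exists_bound_of_continuousOn hcont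
    refine ⟨B, fun κ _ t ht => ?_⟩
    rw [Real.rpow_zero, mul_one, Real.rpow_natCast]
    exact norm_taylorRemainder_le hF N i hB (Ioo_subset_Icc_self ht)
  have hU0 : Ioo 0 T ⊆ Ioi 0 := fun t ht => ht.1
  induction K generalizing N i with
  | zero => exact hbound N i
  | succ K ih =>
    refine SymbolFamily.of_hasDerivAt isOpen_Ioo (hbound N i)
      (fun κ _ t ht => (hasDerivWithinAt_taylorRemainder hF N i
        (Ioo_subset_Icc_self ht)).hasDerivAt (Icc_mem_nhds ht.1 ht.2)) ?_
    have h1 := (SymbolFamily.cpow (K := K) isOpen_Ioo hU0 1).mul isOpen_Ioo hU0 (ih (N - 1) (i + 1))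
    simp only [Complex.cpow_one, add_zero, Complex.one_re] at h1
    rcases N with _ | N
    · exact h1.of_le_of_bounded Ioo_subset_Ioc_self (by simp)
    · convert h1 using 2
      simp [add_comm]

/-- Uniqueness of asymptotic expansions in powers of `t`, for the zero function. -/
theorem eq_zero_of_sum_pow_isBigO {d : ℕ → ℂ}
    (h : ∀ N : ℕ, (fun t : ℝ => ∑ k ∈ Finset.range (N + 1), d k * (t : ℂ) ^ k)
      =O[𝓝[>] 0] fun t : ℝ => t ^ (N + 1)) (k : ℕ) : d k = 0 := by
  induction k using Nat.strong_induction_on with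
  | _ k ih =>
    have h1 : (fun t : ℝ => ∑ i ∈ Finset.range (k + 1), d i * (t : ℂ) ^ i) =
        fun t : ℝ => d k * (t : ℂ) ^ k := by
      funext t
      rw [Finset.sum_range_succ, Finset.sum_eq_zero, zero_add]
      intro i hi
      rw [ih i (Finset.mem_range.1 hi), zero_mul]
    have h2 := h k
    rw [h1] at h2
    obtain ⟨C, hC⟩ := h2.bound
    have h3 : ∀ᶠ t : ℝ in 𝓝[>] 0, ‖d k‖ ≤ C * t := by
      filter_upwards [hC, self_mem_nhdsWithin] with t ht ht0
      have ht0' : 0 < t := ht0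
      rw [norm_mul, norm_pow, Complex.norm_real, norm_pow, Real.norm_of_nonneg ht0'.le, pow_succ,
        mul_comm (t ^ k), ← mul_assoc] at ht
      exact le_of_mul_le_mul_right ht (by positivity)
    have h4 : Tendsto (fun t : ℝ => C * t) (𝓝[>] 0) (𝓝 0) := by
      have : Tendsto (fun t : ℝ => C * t) (𝓝 0) (𝓝 0) :=
        Continuous.tendsto' (by fun_prop) 0 0 (mul_zero C)
      exact this.mono_left nhdsWithin_le_nhds
    exact norm_le_zero_iff.1 (ge_of_tendsto h4 h3)

theorem hasDerivAt_mul_pow_ofReal (κ : ℝ) (i : ℕ) (t : ℝ) :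
    HasDerivAt (fun t : ℝ => ((κ : ℂ) * t) ^ i) (i * ((κ : ℂ) * t) ^ (i - 1) * κ) t := by
  have := ((hasDerivAt_id (t : ℂ)).const_mul (κ : ℂ)).pow i
  simpa using this.comp_ofReal

/-- The Taylor remainder of `w_i (κ t - κ t² / 2)` in powers of the displacement `-κ t² / 2`, where
`w_{i+1}` is the derivative of `w_i`. -/
noncomputable def dilationRemainder (w : ℕ → ℝ → ℂ) (N i : ℕ) (κ t : ℝ) : ℂ :=
  w i (κ * (t - t ^ 2 / 2)) -
    ∑ j ∈ Finset.range N, (-((κ : ℂ) * t ^ 2 / 2)) ^ j / j.factorial * w (i + j) (κ * t)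

theorem hasDerivAt_dilationRemainder {w : ℕ → ℝ → ℂ}
    (hw : ∀ i s, 0 < s → HasDerivAt (w i) (w (i + 1) s) s)
    (N i : ℕ) {κ t : ℝ} (hκ : 0 < κ) (ht : t ∈ Ioo 0 (7 / 4 : ℝ)) :
    HasDerivAt (dilationRemainder w N i κ)
      (κ * dilationRemainder w N (i + 1) κ t - κ * t * dilationRemainder w (N - 1) (i + 1) κ t)
      t := by
  have ht0 := ht.1
  have ht1 := ht.2
  have hpos : 0 < κ * (t - t ^ 2 / 2) := mul_pos hκ (by nlinarith)
  have h0 : HasDerivAt (fun t : ℝ => w i (κ * (t - t ^ 2 / 2)))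
      (((κ * (1 - t) : ℝ) : ℂ) * w (i + 1) (κ * (t - t ^ 2 / 2))) t := by
    have h1 : HasDerivAt (fun t : ℝ => κ * (t - t ^ 2 / 2)) (κ * (1 - t)) t := by
      have := ((hasDerivAt_id t).sub ((hasDerivAt_pow 2 t).div_const 2)).const_mul κ
      refine this.congr_deriv ?_
      simp
    have := (hw i _ hpos).scomp t h1
    simpa [Complex.real_smul, Function.comp_def] using this
  have h1 : ∀ j : ℕ, HasDerivAt (fun t : ℝ => w j (κ * t)) ((κ : ℂ) * w (j + 1) (κ * t)) t := fun j => by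
    have h1 : HasDerivAt (fun t : ℝ => κ * t) κ t := by
      simpa using (hasDerivAt_id t).const_mul κ
    have := (hw j _ (mul_pos hκ ht0)).scomp t h1
    simpa [Complex.real_smul, Function.comp_def] using this
  have h2 : ∀ j : ℕ, HasDerivAt (fun t : ℝ => ((-((κ : ℂ) * t ^ 2 / 2)) ^ j / j.factorial : ℂ))
      ((j : ℂ) * (-((κ : ℂ) * t ^ 2 / 2)) ^ (j - 1) * -((κ : ℂ) * t) / j.factorial) t := fun j => by
    have h3 : HasDerivAt (fun z : ℂ => -((κ : ℂ) * z ^ 2 / 2)) (-((κ : ℂ) * t)) (t : ℂ) := by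
      have := (((hasDerivAt_pow 2 (t : ℂ)).const_mul (κ : ℂ)).div_const 2).neg
      refine this.congr_deriv ?_
      simp
      ring
    exact ((h3.comp_ofReal.pow j).div_const _)
  refine (h0.sub (HasDerivAt.fun_sum fun j _ => (h2 j).mul (h1 (i + j)))).congr_deriv ?_
  rw [Finset.sum_add_distrib]
  have h4 : ∑ j ∈ Finset.range N, (j : ℂ) * (-((κ : ℂ) * t ^ 2 / 2)) ^ (j - 1) *
      -((κ : ℂ) * t) / j.factorial * w (i + j) (κ * t) = -((κ : ℂ) * t) * ∑ j ∈ Finset.range (N - 1),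
        (-((κ : ℂ) * t ^ 2 / 2)) ^ j / j.factorial * w (i + 1 + j) (κ * t) := by
    rcases N with _ | N
    · simp
    · rw [Finset.sum_range_succ', Nat.add_sub_cancel, Finset.mul_sum]
      simp only [Nat.cast_zero, zero_mul, zero_div, add_zero]
      refine Finset.sum_congr rfl fun j _ => ?_
      have : (j.factorial : ℂ) ≠ 0 := by exact_mod_cast j.factorial_ne_zero
      have h2 : (j : ℂ) + 1 ≠ 0 := by exact_mod_cast j.succ_ne_zero
      rw [Nat.add_sub_cancel, Nat.factorial_succ, add_right_comm i 1 j, add_assoc i j 1]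
      push_cast
      field_simp
  have h5 : ∑ j ∈ Finset.range N, (-((κ : ℂ) * t ^ 2 / 2)) ^ j / j.factorial *
      ((κ : ℂ) * w (i + j + 1) (κ * t)) = (κ : ℂ) * ∑ j ∈ Finset.range N,
        (-((κ : ℂ) * t ^ 2 / 2)) ^ j / j.factorial * w (i + 1 + j) (κ * t) := by
    rw [Finset.mul_sum]
    refine Finset.sum_congr rfl fun j _ => ?_
    rw [add_right_comm i 1 j]
    ring
  rw [h4, h5, dilationRemainder, dilationRemainder]
  push_cast
  ring

theorem norm_dilationRemainder_le {w : ℕ → ℝ → ℂ}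
    (hw : ∀ i s, 0 < s → HasDerivAt (w i) (w (i + 1) s) s) {n : ℝ}
    (hb : ∀ i : ℕ, ∃ B : ℝ, ∀ s : ℝ, 0 < s → ‖w i s‖ ≤ B * s ^ (n - i))
    (N i : ℕ) : ∃ B : ℝ, ∀ κ : ℝ, 0 < κ → ∀ t ∈ Ioo 0 (7 / 4 : ℝ),
    ‖((κ : ℂ) * t) ^ i * dilationRemainder w N i κ t‖ ≤ B * κ ^ n * t ^ ((N : ℝ) + n) := by
  obtain ⟨B, hB⟩ := hb (i + N)
  set p : ℝ := n - ((i + N : ℕ) : ℝ) with hp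
  have hB0 : 0 ≤ B := by simpa using (norm_nonneg _).trans (hB 1 one_pos)
  refine ⟨B * 8 ^ |p|, fun κ hκ t ht => ?_⟩
  have ht0 := ht.1
  set s := κ * t with hs
  have hs0 : 0 < s := mul_pos hκ ht0
  -- the function expanded is `w_i (s (1 - x / 2))`, for fixed `s = κ t`
  set F : ℕ → ℝ → ℂ := fun j x => (-(s / 2 : ℂ)) ^ j * w (i + j) (s * (1 - x / 2)) with hF
  have hFd : ∀ j, ∀ x ∈ Icc 0 (7 / 4 : ℝ),
      HasDerivWithinAt (F j) (F (j + 1) x) (Icc 0 (7 / 4)) x := by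
    intro j x hx
    have hpos : 0 < s * (1 - x / 2) := mul_pos hs0 (by linarith [hx.2])
    have h1 : HasDerivAt (fun x : ℝ => s * (1 - x / 2)) (-(s / 2)) x := by
      refine ((((hasDerivAt_id x).div_const 2).const_sub 1).const_mul s).congr_deriv ?_
      ring
    refine (((hw (i + j) _ hpos).scomp x h1).const_mul
      ((-(s / 2 : ℂ)) ^ j)).hasDerivWithinAt.congr_deriv ?_
    simp only [hF, Complex.real_smul, pow_succ, add_assoc]
    push_cast
    ring
  have hbd : ∀ x ∈ Icc 0 (7 / 4 : ℝ), ‖F (0 + N) x‖ ≤ s ^ N * (B * (s ^ p * 8 ^ |p|)) := by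
    intro x hx
    have hl0 : 0 < 1 - x / 2 := by linarith [hx.2]
    have h8 : (1 - x / 2) ^ p ≤ (8 : ℝ) ^ |p| := by
      have hl1 : 1 - x / 2 ≤ 1 := by linarith [hx.1]
      have hl2 : (8 : ℝ)⁻¹ ≤ 1 - x / 2 := by linarith [hx.2]
      calc (1 - x / 2) ^ p ≤ (1 - x / 2) ^ (-|p|) :=
            Real.rpow_le_rpow_of_exponent_ge hl0 hl1 (neg_abs_le p)
        _ ≤ (8 : ℝ)⁻¹ ^ (-|p|) :=
            Real.rpow_le_rpow_of_nonpos (by norm_num) hl2 (by simp)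
        _ = 8 ^ |p| := by rw [Real.inv_rpow (by norm_num), Real.rpow_neg (by norm_num), inv_inv]
    simp only [hF, zero_add]
    rw [norm_mul, norm_pow, norm_neg]
    refine mul_le_mul ?_ ?_ (norm_nonneg _) (by positivity)
    · refine pow_le_pow_left₀ (norm_nonneg _) ?_ N
      rw [norm_div, Complex.norm_real, Real.norm_of_nonneg hs0.le, Complex.norm_ofNat]
      linarith
    · refine (hB _ (mul_pos hs0 hl0)).trans ?_
      rw [Real.mul_rpow hs0.le hl0.le]
      gcongr
  have h1 := norm_taylorRemainder_le hFd N 0 hbd (Ioo_subset_Icc_self ht)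
  have h2 : taylorRemainder F N 0 t = dilationRemainder w N i κ t := by
    rw [taylorRemainder, dilationRemainder]
    simp only [hF, pow_zero, one_mul, zero_add, add_zero, zero_div, sub_zero, mul_one]
    congr 1
    · congr 1
      rw [hs]; ring
    · refine Finset.sum_congr rfl fun j _ => ?_
      rw [hs]
      push_cast
      rw [show -((κ : ℂ) * t ^ 2 / 2) = t * -(κ * t / 2) by ring, mul_pow]
      ring
  rw [h2] at h1
  have h3 : s ^ i * s ^ N * s ^ p = s ^ n := by
    rw [← pow_add, ← Real.rpow_natCast, ← Real.rpow_add hs0, hp]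
    congr 1
    ring
  have h4 : s ^ n = κ ^ n * t ^ n := Real.mul_rpow hκ.le ht0.le
  rw [norm_mul, norm_pow, ← Complex.ofReal_mul, ← hs, Complex.norm_real,
    Real.norm_of_nonneg hs0.le, Real.rpow_add ht0, Real.rpow_natCast]
  calc s ^ i * ‖dilationRemainder w N i κ t‖
      ≤ s ^ i * (s ^ N * (B * (s ^ p * 8 ^ |p|)) * t ^ N) := by gcongr
    _ = B * 8 ^ |p| * (s ^ i * s ^ N * s ^ p) * t ^ N := by ring
    _ = _ := by rw [h3, h4]; ring

/-- Expanding `w_i (κ t (1 - t / 2))` at `κ t` up to order `N` leaves a symbol of order `N + n`. -/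
theorem symbolFamily_dilationRemainder {w : ℕ → ℝ → ℂ}
    (hw : ∀ i s, 0 < s → HasDerivAt (w i) (w (i + 1) s) s) {n : ℝ}
    (hb : ∀ i : ℕ, ∃ B : ℝ, ∀ s : ℝ, 0 < s → ‖w i s‖ ≤ B * s ^ (n - i))
    (N i K : ℕ) :
    SymbolFamily (Ioo 0 (7 / 4)) (N + n) n K
      (fun κ t => ((κ : ℂ) * t) ^ i * dilationRemainder w N i κ t) := by
  have hU0 : Ioo 0 (7 / 4 : ℝ) ⊆ Ioi 0 := fun t ht => ht.1
  induction K generalizing N i with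
  | zero => exact norm_dilationRemainder_le hw hb N i
  | succ K ih =>
    have h3 : SymbolFamily (Ioo 0 (7 / 4)) (N + n) n K (fun κ t => (t : ℂ) *
        (((κ : ℂ) * t) ^ (i + 1) * dilationRemainder w (N - 1) (i + 1) κ t)) := by
      have h1 := (SymbolFamily.cpow (K := K) isOpen_Ioo hU0 1).mul isOpen_Ioo hU0
        (ih (N - 1) (i + 1))
      simp only [Complex.cpow_one, zero_add, Complex.one_re] at h1
      rcases N with _ | N
      · exact h1.of_le_of_bounded Ioo_subset_Ioc_self (by simp)
      · rw [Nat.add_sub_cancel] at h1 ⊢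
        convert h1 using 1
        push_cast
        ring
    have h4 := (((ih N i).const_mul isOpen_Ioo (i : ℂ)).add isOpen_Ioo (ih N (i + 1))).sub
      isOpen_Ioo h3
    refine SymbolFamily.of_hasDerivAt isOpen_Ioo (norm_dilationRemainder_le hw hb N i)
      (fun κ hκ t ht => (hasDerivAt_mul_pow_ofReal κ i t).mul
        (hasDerivAt_dilationRemainder hw N i hκ ht)) (h4.congr isOpen_Ioo fun κ _ t _ => ?_)
    rcases i with _ | i
    · simp
      ring
    · simp only [Nat.add_sub_cancel]
      push_cast
      ring

theorem symbolFamily_pow_mul_comp_mul {w : ℕ → ℝ → ℂ}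
    (hw : ∀ i s, 0 < s → HasDerivAt (w i) (w (i + 1) s) s) {n : ℝ}
    (hb : ∀ i : ℕ, ∃ B : ℝ, ∀ s : ℝ, 0 < s → ‖w i s‖ ≤ B * s ^ (n - i))
    (i K : ℕ) :
    SymbolFamily (Ioi 0) n n K (fun κ t => ((κ : ℂ) * t) ^ i * w i (κ * t)) := by
  have hbound : ∀ i : ℕ, ∃ B : ℝ, ∀ κ : ℝ, 0 < κ → ∀ t ∈ Ioi (0 : ℝ),
      ‖((κ : ℂ) * t) ^ i * w i (κ * t)‖ ≤ B * κ ^ n * t ^ n := by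
    intro i
    obtain ⟨B, hB⟩ := hb i
    refine ⟨B, fun κ hκ t ht => ?_⟩
    have ht0 : 0 < t := ht
    have hs : 0 < κ * t := mul_pos hκ ht0
    rw [norm_mul, norm_pow, ← Complex.ofReal_mul, Complex.norm_real, Real.norm_of_nonneg hs.le,
      mul_assoc, ← Real.mul_rpow hκ.le ht0.le]
    calc (κ * t) ^ i * ‖w i (κ * t)‖ ≤ (κ * t) ^ i * (B * (κ * t) ^ (n - i)) := by
          gcongr; exact hB _ hs
      _ = B * ((κ * t) ^ (i : ℝ) * (κ * t) ^ (n - i)) := by rw [Real.rpow_natCast]; ring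
      _ = _ := by rw [← Real.rpow_add hs]; congr 2; ring
  induction K generalizing i with
  | zero => exact hbound i
  | succ K ih =>
    refine SymbolFamily.of_hasDerivAt isOpen_Ioi (hbound i)
      (fun κ hκ t ht => (hasDerivAt_mul_pow_ofReal κ i t).mul ((hw i _ (mul_pos hκ ht)).scomp t
        (h := fun t : ℝ => κ * t) (by simpa using (hasDerivAt_id t).const_mul κ))) ?_
    refine (((ih i).const_mul isOpen_Ioi (i : ℂ)).add isOpen_Ioi (ih (i + 1))).congr isOpen_Ioi
      fun κ _ t _ => ?_
    rcases i with _ | i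
    · simp [Complex.real_smul]
      ring
    · simp only [Nat.add_sub_cancel, Complex.real_smul]
      push_cast
      ring

/-! ### The Mellin–Barnes integrals of the main terms -/

theorem IsSchwartzOnPos.integrable_mellin_mul {φ : ℝ → ℂ} (hφ : IsSchwartzOnPos φ) {τ : ℝ}
    (hτ : 0 < τ) (j N : ℕ) {G : ℝ → ℂ} (hG : AEStronglyMeasurable G) {A : ℝ}
    (hA : ∀ y, ‖G y‖ ≤ A * (1 + |y|) ^ N) :
    Integrable fun y : ℝ => mellin (eulerFalling φ j) (τ + y * Complex.I) * G y := by
  obtain ⟨B, hB⟩ := hφ.norm_mellin_eulerFalling_le hτ (N + 2) j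
  have hA0 : 0 ≤ A := by simpa using (norm_nonneg _).trans (hA 0)
  refine Integrable.mono' ((integrable_inv_one_add_sq).const_mul (B * A))
    (((hφ.rapidDecayOnPos_eulerFalling j).continuous_mellin hτ).aestronglyMeasurable.mul hG)
    (Eventually.of_forall fun y => ?_)
  set m := ‖mellin (eulerFalling φ j) (τ + y * Complex.I)‖ with hm
  rw [norm_mul, ← div_eq_mul_inv, le_div_iff₀ (by positivity)]
  calc m * ‖G y‖ * (1 + y ^ 2) ≤ m * (A * (1 + |y|) ^ N) * (1 + |y|) ^ 2 := by
        gcongr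
        · exact hA y
        · nlinarith [abs_nonneg y, sq_abs y]
    _ = (1 + |y|) ^ (N + 2) * m * A := by ring
    _ ≤ B * A := by gcongr; exact hB y

theorem norm_cpow_neg_mul_Gamma_le {s z : ℂ} (hs : 0 < s.re) (hz0 : z ≠ 0) (hz : 0 ≤ z.re) :
    ‖z ^ (-s) * Complex.Gamma s‖ ≤ ‖z‖ ^ (-s.re) *
      (Real.exp 1 * Real.Gamma s.re * (Real.pi / 2 * (1 + |s.im|)) ^ s.re) := by
  rw [norm_mul, Complex.norm_cpow_of_ne_zero hz0, Complex.neg_re, Complex.neg_im, mul_neg,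
    Real.exp_neg, div_inv_eq_mul, mul_assoc]
  refine mul_le_mul_of_nonneg_left ?_ (by positivity)
  refine le_trans ?_ (norm_Gamma_mul_exp_le hs)
  rw [mul_comm]
  refine mul_le_mul_of_nonneg_left (Real.exp_le_exp.2 ?_) (norm_nonneg _)
  refine (le_abs_self _).trans ?_
  rw [abs_mul]
  exact mul_le_mul_of_nonneg_right (Complex.abs_arg_le_pi_div_two_iff.2 hz) (abs_nonneg _)

/-- The Mellin–Barnes integrand `Ṽ(u) κ^{u/2} z^{-s} Γ(s)`, with `s = μ + 1 + u / 2`, of the Laplace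
transform of `t^μ V((κ t)^{-1/2})` at `z`. -/
noncomputable def laplaceKernel (V : ℝ → ℂ) (μ : ℂ) (κ : ℝ) (z u : ℂ) : ℂ :=
  mellin V u * ((κ : ℂ) ^ (u / 2) * (z ^ (-(μ + 1 + u / 2)) * Complex.Gamma (μ + 1 + u / 2)))

section Kernel

variable {φ : ℝ → ℂ} {μ : ℂ} {κ τ : ℝ} {z : ℂ}

theorem re_gammaArg_pos (hμ : -1 < μ.re) (hτ : 0 < τ) (y : ℝ) :
    0 < (μ + 1 + (τ + y * Complex.I) / 2).re := by
  simp
  linarith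

theorem exists_norm_laplaceFactor_le (hμ : -1 < μ.re) (hκ : 0 < κ) (hτ : 0 < τ) :
    ∃ (A : ℝ) (N : ℕ), 0 ≤ A ∧ ∀ z : ℂ, z ≠ 0 → 0 ≤ z.re → ∀ y : ℝ,
      ‖(κ : ℂ) ^ (((τ : ℂ) + y * Complex.I) / 2) *
        (z ^ (-(μ + 1 + (τ + y * Complex.I) / 2)) *
          Complex.Gamma (μ + 1 + (τ + y * Complex.I) / 2))‖ ≤
        ‖z‖ ^ (-(μ.re + 1 + τ / 2)) * (A * (1 + |y|) ^ N) := by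
  set σ : ℝ := μ.re + 1 + τ / 2 with hσ
  have hσ0 : 0 < σ := by rw [hσ]; linarith
  set q : ℝ := Real.pi / 2 * (1 + |μ.im|) with hq
  have hq0 : 0 < q := by have := Real.pi_pos; positivity
  refine ⟨κ ^ (τ / 2) * (Real.exp 1 * Real.Gamma σ * q ^ σ), ⌈σ⌉₊,
    by have := Real.Gamma_pos_of_pos hσ0; positivity, fun z hz0 hz y => ?_⟩
  have hre : (μ + 1 + ((τ : ℂ) + y * Complex.I) / 2).re = σ := by simp [hσ]
  have him : (μ + 1 + ((τ : ℂ) + y * Complex.I) / 2).im = μ.im + y / 2 := by simp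
  have h1 := norm_cpow_neg_mul_Gamma_le (s := μ + 1 + ((τ : ℂ) + y * Complex.I) / 2)
    (hre ▸ hσ0) hz0 hz
  rw [hre, him] at h1
  have h2 : Real.pi / 2 * (1 + |μ.im + y / 2|) ≤ q * (1 + |y|) := by
    rw [hq, mul_assoc]
    refine mul_le_mul_of_nonneg_left ?_ (by have := Real.pi_pos; positivity)
    have h3 := abs_add_le μ.im (y / 2)
    rw [abs_div, abs_two] at h3
    nlinarith [abs_nonneg μ.im, abs_nonneg y, mul_nonneg (abs_nonneg μ.im) (abs_nonneg y)]
  have h3 : (Real.pi / 2 * (1 + |μ.im + y / 2|)) ^ σ ≤ q ^ σ * (1 + |y|) ^ ⌈σ⌉₊ := by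
    calc (Real.pi / 2 * (1 + |μ.im + y / 2|)) ^ σ ≤ (q * (1 + |y|)) ^ σ :=
          Real.rpow_le_rpow (by have := Real.pi_pos; positivity) h2 hσ0.le
      _ = q ^ σ * (1 + |y|) ^ σ := Real.mul_rpow hq0.le (by positivity)
      _ ≤ q ^ σ * (1 + |y|) ^ ⌈σ⌉₊ := by
          rw [← Real.rpow_natCast (1 + |y|)]
          gcongr
          · linarith [abs_nonneg y]
          · exact Nat.le_ceil σ
  have h4 : ‖(κ : ℂ) ^ (((τ : ℂ) + y * Complex.I) / 2)‖ = κ ^ (τ / 2) := by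
    rw [Complex.norm_cpow_eq_rpow_re_of_pos hκ]
    simp
  rw [norm_mul, h4]
  have hG := Real.Gamma_pos_of_pos hσ0
  calc κ ^ (τ / 2) * ‖z ^ (-(μ + 1 + ((τ : ℂ) + y * Complex.I) / 2)) *
        Complex.Gamma (μ + 1 + ((τ : ℂ) + y * Complex.I) / 2)‖
      ≤ κ ^ (τ / 2) * (‖z‖ ^ (-σ) *
        (Real.exp 1 * Real.Gamma σ * (q ^ σ * (1 + |y|) ^ ⌈σ⌉₊))) := by
        gcongr
        exact h1.trans (by gcongr)
    _ = _ := by ring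

theorem continuous_laplaceFactor (hμ : -1 < μ.re) (hκ : 0 < κ) (hτ : 0 < τ) (hz0 : z ≠ 0) :
    Continuous fun y : ℝ => (κ : ℂ) ^ (((τ : ℂ) + y * Complex.I) / 2) *
      (z ^ (-(μ + 1 + (τ + y * Complex.I) / 2)) *
        Complex.Gamma (μ + 1 + (τ + y * Complex.I) / 2)) := by
  have hκ0 : (κ : ℂ) ≠ 0 := by exact_mod_cast hκ.ne'
  refine Continuous.mul (Continuous.const_cpow (by fun_prop) (Or.inl hκ0))
    (Continuous.mul (Continuous.const_cpow (by fun_prop) (Or.inl hz0)) ?_)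
  refine continuous_iff_continuousAt.2 fun y => ?_
  have hre := re_gammaArg_pos (μ := μ) hμ hτ y
  have h1 : DifferentiableAt ℂ Complex.Gamma (μ + 1 + (τ + y * Complex.I) / 2) :=
    Complex.differentiableAt_Gamma _ fun m h => by
      rw [h] at hre
      simp at hre
      have : (0 : ℝ) ≤ m := Nat.cast_nonneg m
      linarith
  exact h1.continuousAt.comp (f := fun y : ℝ => μ + 1 + ((τ : ℂ) + y * Complex.I) / 2)
    (by fun_prop)

theorem integrable_laplaceKernel (hφ : IsSchwartzOnPos φ) (hμ : -1 < μ.re) (hκ : 0 < κ)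
    (hτ : 0 < τ) (hz0 : z ≠ 0) (hz : 0 ≤ z.re) (j : ℕ) :
    Integrable fun y : ℝ => laplaceKernel (eulerFalling φ j) μ κ z (τ + y * Complex.I) := by
  obtain ⟨A, N, _, hA⟩ := exists_norm_laplaceFactor_le hμ hκ hτ
  exact hφ.integrable_mellin_mul hτ j N (A := ‖z‖ ^ (-(μ.re + 1 + τ / 2)) * A)
    (continuous_laplaceFactor hμ hκ hτ hz0).aestronglyMeasurable
    fun y => (hA z hz0 hz y).trans_eq (by ring)

/-- The Mellin–Barnes integral is continuous up to the imaginary axis. -/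
theorem tendsto_integral_laplaceKernel (hφ : IsSchwartzOnPos φ) (hμ : -1 < μ.re) (hκ : 0 < κ)
    (hτ : 0 < τ) {η : ℝ} (hη : η ≠ 0) (j : ℕ) :
    Tendsto (fun ε : ℝ => ∫ y : ℝ, laplaceKernel (eulerFalling φ j) μ κ (ε + η * Complex.I)
        (τ + y * Complex.I)) (𝓝[>] 0)
      (𝓝 (∫ y : ℝ, laplaceKernel (eulerFalling φ j) μ κ (η * Complex.I)
        (τ + y * Complex.I))) := by
  obtain ⟨A, N, hA0, hA⟩ := exists_norm_laplaceFactor_le hμ hκ hτ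
  have hne : ∀ ε : ℝ, (ε : ℂ) + η * Complex.I ≠ 0 := fun ε h => hη (by
    simpa using congrArg Complex.im h)
  have hnorm : ∀ ε : ℝ, |η| ≤ ‖(ε : ℂ) + η * Complex.I‖ := fun ε => by
    simpa using Complex.abs_im_le_norm ((ε : ℂ) + η * Complex.I)
  refine tendsto_integral_filter_of_dominated_convergence
    (fun y => ‖mellin (eulerFalling φ j) (τ + y * Complex.I)‖ *
      (|η| ^ (-(μ.re + 1 + τ / 2)) * (A * (1 + |y|) ^ N))) ?_ ?_ ?_ ?_
  · filter_upwards [self_mem_nhdsWithin] with ε hε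
    exact (integrable_laplaceKernel hφ hμ hκ hτ (hne ε)
      (by simpa using le_of_lt hε) j).aestronglyMeasurable
  · filter_upwards [self_mem_nhdsWithin] with ε hε
    refine Eventually.of_forall fun y => ?_
    rw [laplaceKernel, norm_mul]
    refine mul_le_mul_of_nonneg_left ((hA _ (hne ε) (by simpa using le_of_lt hε) y).trans ?_)
      (norm_nonneg _)
    refine mul_le_mul_of_nonneg_right ?_ (by positivity)
    exact Real.rpow_le_rpow_of_nonpos (abs_pos.2 hη) (hnorm ε) (by linarith)
  · have := (hφ.integrable_mellin_mul hτ j N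
      (G := fun y => ((|η| ^ (-(μ.re + 1 + τ / 2)) * (A * (1 + |y|) ^ N) : ℝ) : ℂ))
      (Continuous.aestronglyMeasurable (by fun_prop))
      (A := |η| ^ (-(μ.re + 1 + τ / 2)) * A) (fun y => ?_)).norm
    · refine this.congr (Eventually.of_forall fun y => ?_)
      beta_reduce
      rw [norm_mul, Complex.norm_real, Real.norm_of_nonneg (by positivity)]
    · rw [Complex.norm_real, Real.norm_of_nonneg (by positivity)]
      exact le_of_eq (by ring)
  · refine Eventually.of_forall fun y => ?_
    have hslit : (η : ℂ) * Complex.I ∈ Complex.slitPlane := by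
      simp [Complex.mem_slitPlane_iff, hη]
    have hlim : Tendsto (fun ε : ℝ => (ε : ℂ) + η * Complex.I) (𝓝[>] 0) (𝓝 (η * Complex.I)) := by
      have : Tendsto (fun ε : ℝ => (ε : ℂ) + η * Complex.I) (𝓝 0) (𝓝 (η * Complex.I)) :=
        Continuous.tendsto' (by fun_prop) _ _ (by simp)
      exact this.mono_left nhdsWithin_le_nhds
    simp only [laplaceKernel]
    refine Tendsto.const_mul _ (Tendsto.const_mul _ (Tendsto.mul_const _ ?_))
    exact (continuousAt_cpow_const hslit).tendsto.comp hlim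

theorem cpow_rpow_neg_half {κ t : ℝ} (hκ : 0 < κ) (ht : 0 < t) (u : ℂ) :
    (((κ * t) ^ (-(1 / 2) : ℝ) : ℝ) : ℂ) ^ (-u) = (κ : ℂ) ^ (u / 2) * (t : ℂ) ^ (u / 2) := by
  have hκt : 0 < κ * t := mul_pos hκ ht
  have h0 : ∀ {x : ℝ}, 0 < x → ∀ c : ℂ, (x : ℂ) ^ c = Complex.exp (Real.log x * c) :=
    fun {x} hx c => by
      rw [Complex.cpow_def_of_ne_zero (by exact_mod_cast hx.ne'), Complex.ofReal_log hx.le]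
  rw [h0 (Real.rpow_pos_of_pos hκt _), h0 hκ, h0 ht, ← Complex.exp_add, Real.log_rpow hκt,
    Real.log_mul hκ.ne' ht.ne']
  congr 1
  push_cast
  ring

/-- Laplace transform of `t^μ V((κ t)^{-1/2})`, by Mellin inversion and Euler's integral. -/
theorem integral_cpow_mul_eulerFalling_mul_exp (hφ : IsSchwartzOnPos φ) (hμ : -1 < μ.re)
    (hκ : 0 < κ) (hτ : 0 < τ) (hz : 0 < z.re) (j : ℕ) :
    ∫ t in Ioi (0 : ℝ), (t : ℂ) ^ μ * eulerFalling φ j ((κ * t) ^ (-(1 / 2) : ℝ)) *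
        Complex.exp (-z * t) =
      1 / (2 * Real.pi) * ∫ y : ℝ, laplaceKernel (eulerFalling φ j) μ κ z (τ + y * Complex.I) := by
  have hκ0 : (κ : ℂ) ≠ 0 := by exact_mod_cast hκ.ne'
  set m : ℝ → ℂ := fun y => mellin (eulerFalling φ j) (τ + y * Complex.I) with hm
  set f : ℝ → ℝ → ℂ := fun t y => (κ : ℂ) ^ (((τ : ℂ) + y * Complex.I) / 2) * m y *
    ((t : ℂ) ^ (μ + 1 + ((τ : ℂ) + y * Complex.I) / 2 - 1) * Complex.exp (-z * t)) with hf
  have hinner : ∀ t ∈ Ioi (0 : ℝ), (t : ℂ) ^ μ * eulerFalling φ j ((κ * t) ^ (-(1 / 2) : ℝ)) *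
      Complex.exp (-z * t) = 1 / (2 * Real.pi) * ∫ y : ℝ, f t y := by
    intro t ht
    have ht0 : 0 < t := ht
    have htc : (t : ℂ) ≠ 0 := by exact_mod_cast ht0.ne'
    rw [← hφ.mellin_inversion_eulerFalling hτ j (Real.rpow_pos_of_pos (mul_pos hκ ht0) _)]
    rw [mul_left_comm, mul_assoc, ← integral_const_mul, ← integral_mul_const]
    congr 1
    refine integral_congr_ae (Eventually.of_forall fun y => ?_)
    simp only [hf, hm]
    rw [cpow_rpow_neg_half hκ ht0,
      show μ + 1 + ((τ : ℂ) + y * Complex.I) / 2 - 1 = μ + (τ + y * Complex.I) / 2 by ring,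
      Complex.cpow_add _ _ htc]
    ring
  have houter : ∀ y : ℝ, ∫ t in Ioi (0 : ℝ), f t y =
      laplaceKernel (eulerFalling φ j) μ κ z (τ + y * Complex.I) := by
    intro y
    simp only [hf]
    rw [integral_const_mul,
      integral_cpow_mul_exp_neg_mul_Ioi_of_re_pos (re_gammaArg_pos hμ hτ y) hz, laplaceKernel]
    ring
  have hint : Integrable (Function.uncurry f) ((volume.restrict (Ioi (0 : ℝ))).prod volume) := by
    have h1 : Integrable (fun t : ℝ => (t : ℂ) ^ (μ + 1 + (τ : ℂ) / 2 - 1) * Complex.exp (-z * t))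
        (volume.restrict (Ioi (0 : ℝ))) :=
      integrableOn_cpow_mul_exp_neg (by simpa using re_gammaArg_pos hμ hτ 0) hz
    have h2 : Integrable fun y : ℝ => m y * (κ : ℂ) ^ (((τ : ℂ) + y * Complex.I) / 2) := by
      refine hφ.integrable_mellin_mul hτ j 0 (A := κ ^ (τ / 2)) ?_ fun y => ?_
      · exact (Continuous.const_cpow (by fun_prop) (Or.inl hκ0)).aestronglyMeasurable
      · rw [Complex.norm_cpow_eq_rpow_re_of_pos hκ]
        simp
    have hpos : ∀ᵐ p : ℝ × ℝ ∂((volume.restrict (Ioi (0 : ℝ))).prod volume), 0 < p.1 :=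
      Measure.quasiMeasurePreserving_fst.ae (ae_restrict_mem measurableSet_Ioi)
    have h3 := (h1.mul_prod h2).bdd_mul (c := 1)
      (f := fun p : ℝ × ℝ => (p.1 : ℂ) ^ ((p.2 : ℂ) * Complex.I / 2))
      (Measurable.aestronglyMeasurable (by fun_prop)) (by
        filter_upwards [hpos] with p hp
        rw [Complex.norm_cpow_eq_rpow_re_of_pos hp]
        simp)
    refine h3.congr ?_
    filter_upwards [hpos] with p hp
    have htc : (p.1 : ℂ) ≠ 0 := by exact_mod_cast hp.ne'
    simp only [Function.uncurry, hf]
    rw [show μ + 1 + ((τ : ℂ) + p.2 * Complex.I) / 2 - 1 =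
      (μ + 1 + (τ : ℂ) / 2 - 1) + p.2 * Complex.I / 2 by ring, Complex.cpow_add _ _ htc]
    ring
  rw [setIntegral_congr_fun measurableSet_Ioi hinner, integral_const_mul,
    integral_integral_swap hint]
  simp only [houter]

end Kernel

/-- The principal powers in the transform at `-C²D`, divided by `(-D)^{μ+1}`, combine into a power
of `2πiD`. -/
theorem cpow_twist_div {C D : ℝ} (hC : C ≠ 0) (hD : D ≠ 0) (μ u : ℂ) :
    (Complex.I / (2 * Real.pi)) ^ (μ + 1 + u / 2) * (2 : ℂ) ^ (u / 2) *
        ((-(C ^ 2 * D) : ℝ) : ℂ) ^ (-u / 2) / ((-D : ℝ) : ℂ) ^ (μ + 1) =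
      ((2 / C ^ 2 : ℝ) : ℂ) ^ (u / 2) *
        (((2 * Real.pi * D : ℝ) : ℂ) * Complex.I) ^ (-(μ + 1 + u / 2)) := by
  have hpi := Real.pi_pos
  have hC2 : 0 < C ^ 2 := by positivity
  have hDc : ((-D : ℝ) : ℂ) ≠ 0 := by exact_mod_cast neg_ne_zero.2 hD
  have h2pi : (0 : ℝ) < (2 * Real.pi)⁻¹ := by positivity
  set L := Complex.log ((-D : ℝ) : ℂ) with hL
  have hlogI : Complex.log (Complex.I / (2 * Real.pi)) =
      Real.log (2 * Real.pi)⁻¹ + Real.pi / 2 * Complex.I := by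
    rw [show Complex.I / (2 * Real.pi) = (((2 * Real.pi)⁻¹ : ℝ) : ℂ) * Complex.I by
      push_cast; ring, Complex.log_ofReal_mul h2pi Complex.I_ne_zero, Complex.log_I]
  have hlogx : Complex.log ((-(C ^ 2 * D) : ℝ) : ℂ) = Real.log (C ^ 2) + L := by
    rw [show ((-(C ^ 2 * D) : ℝ) : ℂ) = ((C ^ 2 : ℝ) : ℂ) * ((-D : ℝ) : ℂ) by push_cast; ring,
      Complex.log_ofReal_mul hC2 hDc]
  have hlogz : Complex.log (((2 * Real.pi * D : ℝ) : ℂ) * Complex.I) =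
      L - Complex.log (Complex.I / (2 * Real.pi)) := by
    rw [hlogI, Real.log_inv]
    rcases lt_or_gt_of_ne hD with h | h
    · have h1 : ((2 * Real.pi * D : ℝ) : ℂ) * Complex.I =
          ((2 * Real.pi * -D : ℝ) : ℂ) * -Complex.I := by push_cast; ring
      rw [h1, Complex.log_ofReal_mul (by have := neg_pos.2 h; positivity)
        (neg_ne_zero.2 Complex.I_ne_zero), Complex.log_neg_I, hL, ← Complex.ofReal_log (by linarith),
        Real.log_mul (by positivity) (by linarith)]
      push_cast
      ring
    · have h1 : L = Real.log D + Real.pi * Complex.I := by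
        rw [hL, show ((-D : ℝ) : ℂ) = (D : ℂ) * (-1) by push_cast; ring,
          Complex.log_ofReal_mul h (by norm_num), Complex.log_neg_one]
      rw [h1, Complex.log_ofReal_mul (by positivity) Complex.I_ne_zero, Complex.log_I,
        Real.log_mul (by positivity) h.ne']
      push_cast
      ring
  have hI0 : Complex.I / (2 * Real.pi) ≠ 0 :=
    div_ne_zero Complex.I_ne_zero (by exact_mod_cast (by positivity : (2 * Real.pi) ≠ 0))
  have hx0 : ((-(C ^ 2 * D) : ℝ) : ℂ) ≠ 0 := by
    exact_mod_cast neg_ne_zero.2 (mul_ne_zero hC2.ne' hD)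
  have hz0 : ((2 * Real.pi * D : ℝ) : ℂ) * Complex.I ≠ 0 :=
    mul_ne_zero (by exact_mod_cast mul_ne_zero (by positivity) hD) Complex.I_ne_zero
  have hk : (0 : ℝ) < 2 / C ^ 2 := by positivity
  rw [Complex.cpow_def_of_ne_zero hI0, Complex.cpow_def_of_ne_zero two_ne_zero,
    Complex.cpow_def_of_ne_zero hx0, Complex.cpow_def_of_ne_zero hDc,
    Complex.cpow_def_of_ne_zero (by exact_mod_cast hk.ne'), Complex.cpow_def_of_ne_zero hz0,
    hlogx, hlogz, ← Complex.ofReal_log hk.le, Real.log_div two_ne_zero hC2.ne',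
    ← Complex.exp_add, ← Complex.exp_add, ← Complex.exp_sub, ← Complex.exp_add]
  congr 1
  rw [← hL]
  push_cast
  rw [Complex.ofReal_log zero_le_two]
  push_cast
  ring

theorem transformIntegrand_div {φ : ℝ → ℂ} (hφ : IsSchwartzOnPos φ) (a : ℂ) (c : ℕ → ℂ) (m : ℕ)
    {C D : ℝ} (hC : C ≠ 0) (hD : D ≠ 0) {u : ℂ} (hu : 0 < u.re) :
    transformIntegrand a c m φ (-(C ^ 2 * D)) u / ((-D : ℝ) : ℂ) ^ ((m : ℂ) + 1 + a / 2) =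
      ∑ p ∈ Finset.HasAntidiagonal.antidiagonal m, c p.2 / (-2 : ℂ) ^ p.1 / p.1.factorial *
        laplaceKernel (eulerFalling φ p.1) (a / 2 + m) (2 / C ^ 2)
          (((2 * Real.pi * D : ℝ) : ℂ) * Complex.I) u := by
  have h1 := cpow_twist_div hC hD (a / 2 + m) u
  have h2 : transformIntegrand a c m φ (-(C ^ 2 * D)) u / ((-D : ℝ) : ℂ) ^ ((m : ℂ) + 1 + a / 2) =
      (∑ p ∈ Finset.HasAntidiagonal.antidiagonal m,
        c p.2 / (-2 : ℂ) ^ p.1 * Ring.choose (u / 2) p.1) *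
      (mellin φ u * Complex.Gamma (a / 2 + m + 1 + u / 2) *
        ((Complex.I / (2 * Real.pi)) ^ (a / 2 + m + 1 + u / 2) * (2 : ℂ) ^ (u / 2) *
        ((-(C ^ 2 * D) : ℝ) : ℂ) ^ (-u / 2) / ((-D : ℝ) : ℂ) ^ (a / 2 + m + 1))) := by
    rw [transformIntegrand, twistedCoeff,
      show 1 + (m : ℂ) + (u + a) / 2 = a / 2 + m + 1 + u / 2 by ring,
      show (m : ℂ) + 1 + (a + u) / 2 = a / 2 + m + 1 + u / 2 by ring,
      show (m : ℂ) + 1 + a / 2 = a / 2 + m + 1 by ring]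
    ring
  rw [h2, h1, Finset.sum_mul]
  refine Finset.sum_congr rfl fun p _ => ?_
  rw [laplaceKernel, hφ.mellin_eulerFalling p.1 hu]
  have : (p.1.factorial : ℂ) ≠ 0 := by exact_mod_cast p.1.factorial_ne_zero
  field_simp

section Transform

variable {φ : ℝ → ℂ} {a : ℂ} {τ C D : ℝ}

theorem re_half_add_nat_gt (ha : -2 < a.re) (m : ℕ) : -1 < (a / 2 + m).re := by
  have : (0 : ℝ) ≤ m := Nat.cast_nonneg m
  simp
  linarith

theorem integrable_transformIntegrand (hφ : IsSchwartzOnPos φ) (ha : -2 < a.re) (c : ℕ → ℂ) (m : ℕ)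
    (hτ : 0 < τ) (hC : C ≠ 0) (hD : D ≠ 0) :
    Integrable fun t : ℝ =>
      transformIntegrand a c m φ (-(C ^ 2 * D)) (τ + t * Complex.I) := by
  have hz0 : ((2 * Real.pi * D : ℝ) : ℂ) * Complex.I ≠ 0 :=
    mul_ne_zero (by exact_mod_cast mul_ne_zero (by have := Real.pi_pos; positivity) hD)
      Complex.I_ne_zero
  have hDc : ((-D : ℝ) : ℂ) ^ ((m : ℂ) + 1 + a / 2) ≠ 0 := by
    have : ((-D : ℝ) : ℂ) ≠ 0 := by exact_mod_cast neg_ne_zero.2 hD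
    simp only [ne_eq, Complex.cpow_eq_zero_iff, this, false_and, not_false_eq_true]
  have h1 := (integrable_finsetSum (Finset.HasAntidiagonal.antidiagonal m) fun p _ =>
    (integrable_laplaceKernel hφ (re_half_add_nat_gt ha m) (κ := 2 / C ^ 2) (by positivity) hτ hz0
      (by simp) p.1).const_mul (c p.2 / (-2 : ℂ) ^ p.1 / p.1.factorial)).mul_const
        (((-D : ℝ) : ℂ) ^ ((m : ℂ) + 1 + a / 2))
  refine h1.congr (Eventually.of_forall fun t => ?_)
  beta_reduce
  rw [← transformIntegrand_div hφ a c m hC hD (by simpa using hτ), div_mul_cancel₀ _ hDc]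

theorem mellinBarnes_div (hφ : IsSchwartzOnPos φ) (ha : -2 < a.re) (c : ℕ → ℂ) (m : ℕ)
    (hτ : 0 < τ) (hC : C ≠ 0) (hD : D ≠ 0) :
    mellinBarnes a c m τ φ (-(C ^ 2 * D)) / ((-D : ℝ) : ℂ) ^ ((m : ℂ) + 1 + a / 2) =
      ∑ p ∈ Finset.HasAntidiagonal.antidiagonal m, c p.2 / (-2 : ℂ) ^ p.1 / p.1.factorial *
        (1 / (2 * Real.pi) * ∫ y : ℝ, laplaceKernel (eulerFalling φ p.1) (a / 2 + m) (2 / C ^ 2)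
          (((2 * Real.pi * D : ℝ) : ℂ) * Complex.I) (τ + y * Complex.I)) := by
  have hz0 : ((2 * Real.pi * D : ℝ) : ℂ) * Complex.I ≠ 0 :=
    mul_ne_zero (by exact_mod_cast mul_ne_zero (by have := Real.pi_pos; positivity) hD)
      Complex.I_ne_zero
  rw [mellinBarnes, mul_div_assoc, ← integral_div]
  simp only [mul_left_comm _ (1 / (2 * (Real.pi : ℂ)))]
  rw [← Finset.mul_sum]
  congr 1
  simp only [← integral_const_mul]
  rw [← integral_finsetSum _ fun p _ => (integrable_laplaceKernel hφ (re_half_add_nat_gt ha m)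
    (κ := 2 / C ^ 2) (by positivity) hτ hz0 (by simp) p.1).const_mul _]
  refine integral_congr_ae (Eventually.of_forall fun t => ?_)
  exact transformIntegrand_div hφ a c m hC hD (by simpa using hτ)

end Transform

/-! ### Expansion of the integrand at an endpoint -/

/-- The `i`-th derivative of `s ↦ φ(s^{-1/2})` on `(0, ∞)`. -/
noncomputable def invSqrtDeriv (φ : ℝ → ℂ) (i : ℕ) (s : ℝ) : ℂ :=
  ((s : ℂ) ^ i)⁻¹ * eulerFalling φ i (s ^ (-(1 / 2) : ℝ))

namespace IsSchwartzOnPos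

variable {φ : ℝ → ℂ}

theorem hasDerivAt_invSqrtDeriv (hφ : IsSchwartzOnPos φ) (i : ℕ) (s : ℝ) (hs : 0 < s) :
    HasDerivAt (invSqrtDeriv φ i) (invSqrtDeriv φ (i + 1) s) s := by
  have hs0 : (s : ℂ) ≠ 0 := by exact_mod_cast hs.ne'
  have h1 : HasDerivAt (fun s : ℝ => ((s : ℂ) ^ i)⁻¹)
      (-(i * (s : ℂ) ^ (i - 1)) / ((s : ℂ) ^ i) ^ 2) s :=
    ((hasDerivAt_pow i (s : ℂ)).inv (pow_ne_zero i hs0)).comp_ofReal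
  have h2 : HasDerivAt (fun s : ℝ => s ^ (-(1 / 2) : ℝ))
      (-(1 / 2) * s ^ (-(1 / 2) - 1 : ℝ)) s := Real.hasDerivAt_rpow_const (Or.inl hs.ne')
  have h3 := (hφ.hasDerivAt_eulerFalling i (Real.rpow_pos_of_pos hs (-(1 / 2)))).scomp s h2
  refine (h1.mul h3).congr_deriv ?_
  have hy : ((s ^ (-(1 / 2) : ℝ) : ℝ) : ℂ) ≠ 0 := by
    exact_mod_cast (Real.rpow_pos_of_pos hs _).ne'
  have h4 : s ^ (-(1 / 2) - 1 : ℝ) = s ^ (-(1 / 2) : ℝ) / s := by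
    rw [Real.rpow_sub hs, Real.rpow_one]
  rw [h4, invSqrtDeriv]
  simp only [Complex.real_smul, Function.comp]
  push_cast
  rcases i with _ | i
  · simp
    field_simp
  · simp only [Nat.add_sub_cancel]
    push_cast
    field_simp
    ring

theorem norm_invSqrtDeriv_le (hφ : IsSchwartzOnPos φ) {n : ℝ} (hn : 0 ≤ n) (i : ℕ) :
    ∃ B : ℝ, ∀ s : ℝ, 0 < s → ‖invSqrtDeriv φ i s‖ ≤ B * s ^ (n - i) := by
  obtain ⟨B, hB⟩ := (hφ.rapidDecayOnPos_eulerFalling i).2 (2 * n) (by linarith)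
  refine ⟨B, fun s hs => ?_⟩
  have h1 := hB _ (Real.rpow_pos_of_pos hs (-(1 / 2)))
  rw [← Real.rpow_mul hs.le, show -(1 / 2) * -(2 * n) = n by ring] at h1
  rw [invSqrtDeriv, norm_mul, norm_inv, norm_pow, Complex.norm_real, Real.norm_of_nonneg hs.le,
    Real.rpow_sub hs, Real.rpow_natCast, inv_mul_eq_div, mul_div_assoc']
  gcongr

end IsSchwartzOnPos

theorem pow_mul_invSqrtDeriv (φ : ℝ → ℂ) (i : ℕ) {s : ℝ} (hs : 0 < s) :
    (s : ℂ) ^ i * invSqrtDeriv φ i s = eulerFalling φ i (s ^ (-(1 / 2) : ℝ)) := by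
  have hs0 : (s : ℂ) ^ i ≠ 0 := pow_ne_zero i (by exact_mod_cast hs.ne')
  rw [invSqrtDeriv, mul_inv_cancel_left₀ hs0]

/-- A smooth function on `[0, T]` differs from its asymptotic expansion up to degree `N - 1` by a
symbol of order `N`. -/
theorem symbolFamily_sub_sum_pow {f : ℝ → ℂ} {T : ℝ} (hT : 0 < T) (hf : ContDiffOn ℝ ∞ f (Icc 0 T))
    {c : ℕ → ℂ}
    (hc : ∀ N : ℕ, (fun t : ℝ => f t - ∑ k ∈ Finset.range (N + 1), c k * (t : ℂ) ^ k)
      =O[𝓝[>] 0] fun t : ℝ => t ^ (N + 1)) (N K : ℕ) :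
    SymbolFamily (Ioo 0 T) N 0 K
      (fun _ t => f t - ∑ k ∈ Finset.range N, c k * (t : ℂ) ^ k) := by
  set F : ℕ → ℝ → ℂ := fun i => iteratedDerivWithin i f (Icc 0 T) with hF
  have hFd : ∀ i, ∀ t ∈ Icc 0 T, HasDerivWithinAt (F i) (F (i + 1) t) (Icc 0 T) t := by
    intro i t ht
    have h1 := (hf.differentiableOn_iteratedDerivWithin (m := i)
      (by exact_mod_cast WithTop.coe_lt_top _) (uniqueDiffOn_Icc hT)) t ht
    have h2 := h1.hasDerivWithinAt
    simp only [hF]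
    rwa [iteratedDerivWithin_succ]
  have hF0 : F 0 = f := by simp [hF]
  have hcoef : ∀ k, c k = F k 0 / k.factorial := by
    intro k
    refine (sub_eq_zero.1 (eq_zero_of_sum_pow_isBigO (d := fun k => F k 0 / k.factorial - c k)
      (fun N => ?_) k)).symm
    obtain ⟨B, hB⟩ := isCompact_Icc.exists_bound_of_continuousOn
      (f := F (0 + (N + 1))) (fun t ht => (hFd _ t ht).continuousWithinAt)
    have h1 : (fun t : ℝ => taylorRemainder F (N + 1) 0 t) =O[𝓝[>] 0] fun t : ℝ => t ^ (N + 1) := by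
      refine Asymptotics.IsBigO.of_bound B ?_
      filter_upwards [Ioo_mem_nhdsGT hT] with t ht
      rw [Real.norm_of_nonneg (pow_nonneg ht.1.le _)]
      exact norm_taylorRemainder_le hFd (N + 1) 0 hB (Ioo_subset_Icc_self ht)
    refine ((hc N).sub h1).congr_left fun t => ?_
    rw [taylorRemainder, hF0, sub_sub_sub_cancel_left, ← Finset.sum_sub_distrib]
    refine Finset.sum_congr rfl fun k _ => ?_
    rw [zero_add]
    ring
  refine (symbolFamily_taylorRemainder hFd N 0 K).congr isOpen_Ioo fun _ _ t _ => ?_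
  rw [taylorRemainder, hF0]
  congr 1
  refine Finset.sum_congr rfl fun k _ => ?_
  rw [hcoef k, zero_add]
  ring

/-- A smooth cutoff, equal to `1` for `t ≤ 1/2` and to `0` for `t ≥ 3/2`, which together with its
reflection in `t = 1` is a partition of unity. -/
noncomputable def cutoff (t : ℝ) : ℂ := Real.smoothTransition (3 / 2 - t)

theorem cutoff_of_le {t : ℝ} (h : t ≤ 1 / 2) : cutoff t = 1 := by
  rw [cutoff, Real.smoothTransition.one_of_one_le (by linarith), Complex.ofReal_one]

theorem cutoff_of_ge {t : ℝ} (h : 3 / 2 ≤ t) : cutoff t = 0 := by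
  rw [cutoff, Real.smoothTransition.zero_of_nonpos (by linarith), Complex.ofReal_zero]

theorem cutoff_add_cutoff (t : ℝ) : cutoff t + cutoff (2 - t) = 1 := by
  rw [cutoff, cutoff, ← Complex.ofReal_add, show 3 / 2 - (2 - t) = 1 - (3 / 2 - t) by ring]
  have h1 := Real.smoothTransition.pos_denom (3 / 2 - t)
  simp only [Real.smoothTransition, sub_sub_cancel]
  rw [add_comm (expNegInvGlue (1 - (3 / 2 - t))), ← add_div, div_self h1.ne', Complex.ofReal_one]

theorem contDiff_cutoff : ContDiff ℝ ∞ cutoff :=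
  Complex.ofRealCLM.contDiff.comp (Real.smoothTransition.contDiff.comp (by fun_prop))

theorem symbolFamily_one_sub_cutoff (γ K : ℕ) :
    SymbolFamily (Ioi 0) γ 0 K (fun _ t => 1 - cutoff t) := by
  have h1 : SymbolFamily (Ioo 0 (7 / 4)) γ 0 K (fun _ t => 1 - cutoff t) := by
    have := symbolFamily_sub_sum_pow (f := fun t => 1 - cutoff t) (T := 7 / 4) (by norm_num)
      (contDiff_const.sub contDiff_cutoff).contDiffOn (c := fun _ => 0) (fun N => ?_) γ K
    · simpa using this
    · refine Asymptotics.IsBigO.of_bound 1 ?_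
      filter_upwards [Ioo_mem_nhdsGT (show (0 : ℝ) < 1 / 2 by norm_num)] with t ht
      simp [cutoff_of_le ht.2.le]
  have h2 : SymbolFamily (Ioi (3 / 2)) γ 0 K (fun _ t => 1 - cutoff t) := by
    have h3 : SymbolFamily (Ioi (3 / 2)) γ 0 K (fun _ _ => (1 : ℂ)) := by
      have hb : ∃ B : ℝ, ∀ κ : ℝ, 0 < κ → ∀ t ∈ Ioi (3 / 2 : ℝ),
          ‖(1 : ℂ)‖ ≤ B * κ ^ (0 : ℝ) * t ^ (γ : ℝ) := by
        refine ⟨1, fun κ _ t ht => ?_⟩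
        have ht' : 3 / 2 < t := ht
        simpa using one_le_pow₀ (by linarith : (1 : ℝ) ≤ t)
      cases K with
      | zero => exact hb
      | succ K =>
        exact SymbolFamily.of_hasDerivAt isOpen_Ioi hb (fun κ _ t _ => hasDerivAt_const t (1 : ℂ))
          (by simpa using SymbolFamily.zero isOpen_Ioi)
    refine h3.congr isOpen_Ioi fun _ _ t ht => ?_
    rw [cutoff_of_ge (le_of_lt ht), sub_zero]
  exact .of_Ioo_of_Ioi (by norm_num) (by norm_num) h1 h2

theorem symbolFamily_cutoff (K : ℕ) : SymbolFamily (Ioi 0) 0 0 K (fun _ t => cutoff t) := by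
  have h1 : SymbolFamily (Ioi 0) 0 0 K (fun _ t => (t : ℂ) ^ 0) := by
    simpa using SymbolFamily.pow (K := K) isOpen_Ioi Subset.rfl 0
  have h2 := symbolFamily_one_sub_cutoff 0 K
  rw [Nat.cast_zero] at h2
  refine (h1.sub isOpen_Ioi h2).congr isOpen_Ioi fun _ _ t _ => ?_
  simp

/-- A symbol on a neighbourhood in `(0, ∞)` of the support of the cutoff becomes a symbol on all of
`(0, ∞)` after multiplication by the cutoff. -/
theorem symbolFamily_cutoff_mul {β n : ℝ} {K : ℕ} {f : ℝ → ℝ → ℂ}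
    (h : SymbolFamily (Ioo 0 (7 / 4)) β n K f) :
    SymbolFamily (Ioi 0) β n K (fun κ t => cutoff t * f κ t) := by
  have h1 : SymbolFamily (Ioo 0 (7 / 4)) β n K (fun κ t => cutoff t * f κ t) := by
    simpa using ((symbolFamily_cutoff K).mono (fun t ht => ht.1)).mul isOpen_Ioo
      (fun t ht => ht.1) h
  have h2 : SymbolFamily (Ioi (3 / 2)) β n K (fun κ t => cutoff t * f κ t) :=
    (SymbolFamily.zero isOpen_Ioi).congr isOpen_Ioi fun _ _ t ht => by
      rw [cutoff_of_ge (le_of_lt ht), zero_mul]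
  exact .of_Ioo_of_Ioi (by norm_num) (by norm_num) h1 h2

/-- The integrand near the endpoint, in terms of the distance `t` to it and with `κ = 2 / C²`; the
phase is left out. -/
noncomputable def endpointIntegrand (φ g : ℝ → ℂ) (a : ℂ) (κ t : ℝ) : ℂ :=
  cutoff t * ((t : ℂ) ^ (a / 2) * (g t * invSqrtDeriv φ 0 (κ * (t - t ^ 2 / 2))))

/-- The function `t^{a/2+m} V_j((κt)^{-1/2})` with `V_j = eulerFalling φ j`; the endpoint expansion
consists of these terms, with `m ≥ j`. -/
noncomputable def endpointTerm (φ : ℝ → ℂ) (a : ℂ) (m j : ℕ) (κ t : ℝ) : ℂ :=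
  (t : ℂ) ^ (a / 2 + m) * eulerFalling φ j ((κ * t) ^ (-(1 / 2) : ℝ))

section Endpoint

variable {φ g : ℝ → ℂ} {a : ℂ} {c : ℕ → ℂ} {n : ℝ}

theorem symbolFamily_endpointTerm (hφ : IsSchwartzOnPos φ) (hn : 0 ≤ n) (m j K : ℕ) :
    SymbolFamily (Ioi 0) ((a / 2 + m).re + n) n K (endpointTerm φ a m j) := by
  have h1 := (SymbolFamily.cpow (K := K) isOpen_Ioi Subset.rfl (a / 2 + m)).mul isOpen_Ioi
    Subset.rfl (symbolFamily_pow_mul_comp_mul hφ.hasDerivAt_invSqrtDeriv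
      (hφ.norm_invSqrtDeriv_le hn) j K)
  rw [zero_add] at h1
  refine h1.congr isOpen_Ioi fun κ hκ t ht => ?_
  rw [endpointTerm, ← pow_mul_invSqrtDeriv φ j (mul_pos hκ ht), Complex.ofReal_mul]

theorem endpointTerm_eq {κ t : ℝ} (hκ : 0 < κ) (ht : 0 < t) (k j : ℕ) :
    (-1 / 2 : ℂ) ^ j / j.factorial * endpointTerm φ a (k + j) j κ t =
      (t : ℂ) ^ (a / 2) * ((t : ℂ) ^ k *
        ((-((κ : ℂ) * t ^ 2 / 2)) ^ j / j.factorial * invSqrtDeriv φ (0 + j) (κ * t))) := by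
  have htc : (t : ℂ) ≠ 0 := by exact_mod_cast ht.ne'
  rw [endpointTerm, ← pow_mul_invSqrtDeriv φ j (mul_pos hκ ht), Complex.cpow_add _ _ htc,
    Complex.cpow_natCast, zero_add, Complex.ofReal_mul,
    show -((κ : ℂ) * t ^ 2 / 2) = (-1 / 2) * t * (κ * t) by ring, mul_pow, mul_pow, pow_add]
  ring

/-- The integrand near an endpoint minus its expansion is a symbol on `(0, ∞)` whose order exceeds
that of the last retained term. -/
theorem symbolFamily_endpointRemainder (hφ : IsSchwartzOnPos φ)
    (hg : ContDiffOn ℝ ∞ g (Icc 0 (7 / 4)))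
    (hc : ∀ N : ℕ, (fun t : ℝ => g t - ∑ k ∈ Finset.range (N + 1), c k * (t : ℂ) ^ k)
      =O[𝓝[>] 0] fun t : ℝ => t ^ (N + 1)) (hn : 0 ≤ n) (M K : ℕ) :
    SymbolFamily (Ioi 0) ((a / 2).re + (M + 1) + n) n K (fun κ t =>
      endpointIntegrand φ g a κ t - ∑ k ∈ Finset.range (M + 1), ∑ j ∈ Finset.range (M + 1 - k),
        c k * ((-1 / 2 : ℂ) ^ j / j.factorial) * endpointTerm φ a (k + j) j κ t) := by
  set w := invSqrtDeriv φ with hw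
  have hwd := hφ.hasDerivAt_invSqrtDeriv
  have hwb := hφ.norm_invSqrtDeriv_le hn
  have hU0 : Ioo 0 (7 / 4 : ℝ) ⊆ Ioi 0 := fun t ht => ht.1
  have hE : ∀ N : ℕ, SymbolFamily (Ioo 0 (7 / 4)) (N + n) n K (dilationRemainder w N 0) := fun N => by
    simpa using symbolFamily_dilationRemainder hwd hwb N 0 K
  -- the part near the endpoint: expand `g` first, then the second factor in each monomial
  have h1 : SymbolFamily (Ioo 0 (7 / 4)) ((M + 1) + n) n K (fun κ t =>
      (g t - ∑ k ∈ Finset.range (M + 1), c k * (t : ℂ) ^ k) * dilationRemainder w 0 0 κ t +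
        ∑ k ∈ Finset.range (M + 1),
          c k * ((t : ℂ) ^ k * dilationRemainder w (M + 1 - k) 0 κ t)) := by
    refine SymbolFamily.add isOpen_Ioo ?_ (SymbolFamily.sum isOpen_Ioo _ fun k hk => ?_)
    · have := (symbolFamily_sub_sum_pow (by norm_num) hg hc (M + 1) K).mul isOpen_Ioo hU0 (hE 0)
      simpa using this
    · have := ((SymbolFamily.pow (K := K) isOpen_Ioo hU0 k).mul isOpen_Ioo hU0
        (hE (M + 1 - k))).const_mul isOpen_Ioo (c k)
      rw [zero_add, Nat.cast_sub (Finset.mem_range.1 hk).le] at this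
      convert this using 1
      push_cast
      ring
  have h2 := symbolFamily_cutoff_mul
    ((SymbolFamily.cpow (K := K) isOpen_Ioo hU0 (a / 2)).mul isOpen_Ioo hU0 h1)
  -- the part away from the endpoint, where only the expansion contributes
  have h3 : SymbolFamily (Ioi 0) ((a / 2).re + (M + 1) + n) n K (fun κ t =>
      ∑ k ∈ Finset.range (M + 1), ∑ j ∈ Finset.range (M + 1 - k),
        c k * ((-1 / 2 : ℂ) ^ j / j.factorial) *
          ((1 - cutoff t) * endpointTerm φ a (k + j) j κ t)) := by
    refine SymbolFamily.sum isOpen_Ioi _ fun k hk => SymbolFamily.sum isOpen_Ioi _ fun j hj => ?_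
    have hk' := Finset.mem_range.1 hk
    have hj' := Finset.mem_range.1 hj
    have := ((symbolFamily_one_sub_cutoff (M + 1 - (k + j)) K).mul isOpen_Ioi Subset.rfl
      (symbolFamily_endpointTerm (a := a) hφ hn (k + j) j K)).const_mul isOpen_Ioi
        (c k * ((-1 / 2 : ℂ) ^ j / j.factorial))
    rw [zero_add, Nat.cast_sub (by omega)] at this
    convert this using 1
    simp
    ring
  rw [zero_add, ← add_assoc] at h2
  refine (h2.sub isOpen_Ioi h3).congr isOpen_Ioi fun κ hκ t ht => ?_
  have h4 : ∑ k ∈ Finset.range (M + 1), ∑ j ∈ Finset.range (M + 1 - k),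
      c k * ((-1 / 2 : ℂ) ^ j / j.factorial) * endpointTerm φ a (k + j) j κ t =
      (t : ℂ) ^ (a / 2) * ∑ k ∈ Finset.range (M + 1), c k * ((t : ℂ) ^ k *
        ∑ j ∈ Finset.range (M + 1 - k),
          (-((κ : ℂ) * t ^ 2 / 2)) ^ j / j.factorial * w (0 + j) (κ * t)) := by
    simp only [Finset.mul_sum, mul_assoc]
    refine Finset.sum_congr rfl fun k _ => Finset.sum_congr rfl fun j _ => ?_
    rw [endpointTerm_eq hκ ht]
    ring
  have h5 : ∑ k ∈ Finset.range (M + 1), ∑ j ∈ Finset.range (M + 1 - k),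
      c k * ((-1 / 2 : ℂ) ^ j / j.factorial) *
          ((1 - cutoff t) * endpointTerm φ a (k + j) j κ t) =
      (1 - cutoff t) * ∑ k ∈ Finset.range (M + 1), ∑ j ∈ Finset.range (M + 1 - k),
      c k * ((-1 / 2 : ℂ) ^ j / j.factorial) * endpointTerm φ a (k + j) j κ t := by
    simp only [Finset.mul_sum]
    refine Finset.sum_congr rfl fun k _ => Finset.sum_congr rfl fun j _ => ?_
    ring
  have h6 : ∑ k ∈ Finset.range (M + 1), c k * ((t : ℂ) ^ k * dilationRemainder w (M + 1 - k) 0 κ t) =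
      (∑ k ∈ Finset.range (M + 1), c k * (t : ℂ) ^ k) * w 0 (κ * (t - t ^ 2 / 2)) -
        ∑ k ∈ Finset.range (M + 1), c k * ((t : ℂ) ^ k *
        ∑ j ∈ Finset.range (M + 1 - k),
          (-((κ : ℂ) * t ^ 2 / 2)) ^ j / j.factorial * w (0 + j) (κ * t)) := by
    rw [Finset.sum_mul, ← Finset.sum_sub_distrib]
    refine Finset.sum_congr rfl fun k _ => ?_
    rw [dilationRemainder]
    ring
  rw [h5, h4, h6, endpointIntegrand, dilationRemainder, Finset.sum_range_zero, sub_zero]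
  ring

end Endpoint

/-! ### The contribution of an endpoint -/

section Endpoint

variable {φ g : ℝ → ℂ} {a : ℂ} {c : ℕ → ℂ} {n : ℝ}

theorem integrableOn_endpointIntegrand (hφ : IsSchwartzOnPos φ) (ha : -2 < a.re)
    (hg : ContDiffOn ℝ ∞ g (Icc 0 (7 / 4)))
    (hc : ∀ N : ℕ, (fun t : ℝ => g t - ∑ k ∈ Finset.range (N + 1), c k * (t : ℂ) ^ k)
      =O[𝓝[>] 0] fun t : ℝ => t ^ (N + 1)) {κ : ℝ} (hκ : 0 < κ) :
    IntegrableOn (endpointIntegrand φ g a κ) (Ioi 0) := by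
  have hre : (a / 2).re = a.re / 2 := by simp
  have h1 := (symbolFamily_endpointRemainder (a := a) hφ hg hc le_rfl 0 1).integrableOn_mul_exp
    (by rw [hre]; push_cast; linarith) hκ (z := 1) (by simp)
  have h2 := ((symbolFamily_endpointTerm (a := a) hφ le_rfl 0 0 1).integrableOn_mul_exp
    (by have := re_half_add_nat_gt ha 0; linarith) hκ (z := 1) (by simp)).const_mul (c 0)
  have h3 : IntegrableOn (fun t => endpointIntegrand φ g a κ t * Complex.exp (-1 * t)) (Ioi 0) := by
    refine (h1.add h2).congr (Eventually.of_forall fun t => ?_)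
    simp
    ring
  -- the cutoff makes the exponential weight harmless
  have h4 := h3.bdd_mul (c := Real.exp (3 / 2))
    (f := fun t : ℝ => ((Real.exp (min t (3 / 2)) : ℝ) : ℂ))
    (Continuous.aestronglyMeasurable (by fun_prop)) (Eventually.of_forall fun t => by
      rw [Complex.norm_real, Real.norm_of_nonneg (Real.exp_pos _).le, Real.exp_le_exp]
      exact min_le_right _ _)
  refine h4.congr (Eventually.of_forall fun t => ?_)
  beta_reduce
  rcases le_total t (3 / 2) with h | h
  · rw [min_eq_left h, mul_left_comm, Complex.ofReal_exp, ← Complex.exp_add]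
    simp
  · rw [endpointIntegrand, cutoff_of_ge h]
    simp

/-- Asymptotic expansion of the contribution of one endpoint, with the main terms given as
Mellin–Barnes integrals on any line `Re u = τ > 0`. -/
theorem exists_norm_integral_endpoint_sub_le (hφ : IsSchwartzOnPos φ) (ha : -2 < a.re)
    (hg : ContDiffOn ℝ ∞ g (Icc 0 (7 / 4)))
    (hc : ∀ N : ℕ, (fun t : ℝ => g t - ∑ k ∈ Finset.range (N + 1), c k * (t : ℂ) ^ k)
      =O[𝓝[>] 0] fun t : ℝ => t ^ (N + 1)) (hn : 0 ≤ n) (M : ℕ) :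
    ∃ A : ℝ, ∀ κ : ℝ, 0 < κ → ∀ τ : ℝ, 0 < τ → ∀ η : ℝ, η ≠ 0 →
      ‖(∫ t in Ioi (0 : ℝ), endpointIntegrand φ g a κ t * Complex.exp (-(η * Complex.I) * t)) -
        ∑ k ∈ Finset.range (M + 1), ∑ j ∈ Finset.range (M + 1 - k),
          c k * ((-1 / 2 : ℂ) ^ j / j.factorial) * (1 / (2 * Real.pi) *
            ∫ y : ℝ, laplaceKernel (eulerFalling φ j) (a / 2 + (k + j : ℕ)) κ (η * Complex.I)
              (τ + y * Complex.I))‖ ≤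
        A * κ ^ n * |η| ^ (-((a / 2).re + (M + 1) + n + 1)) := by
  set β : ℝ := (a / 2).re + (M + 1) + n with hβ
  have hre : (a / 2).re = a.re / 2 := by simp
  have hM : (0 : ℝ) ≤ M := Nat.cast_nonneg M
  have hβ1 : -1 < β := by rw [hβ, hre]; linarith
  obtain ⟨A, hA⟩ := (symbolFamily_endpointRemainder (a := a) hφ hg hc hn M
    (⌈β + 1⌉₊ + 1)).norm_integral_le (by push_cast; linarith [Nat.le_ceil (β + 1)]) hβ1
  refine ⟨|A|, fun κ hκ τ hτ η hη => ?_⟩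
  have hGint := integrableOn_endpointIntegrand hφ ha hg hc hκ
  set G := endpointIntegrand φ g a κ with hG
  set J : ℂ → ℕ → ℕ → ℂ := fun z k j => 1 / (2 * Real.pi) *
    ∫ y : ℝ, laplaceKernel (eulerFalling φ j) (a / 2 + (k + j : ℕ)) κ z (τ + y * Complex.I) with hJ
  -- the bound in the open right half-plane
  have hright : ∀ z : ℂ, 0 < z.re → ‖(∫ t in Ioi (0 : ℝ), G t * Complex.exp (-z * t)) -
      ∑ k ∈ Finset.range (M + 1), ∑ j ∈ Finset.range (M + 1 - k),
        c k * ((-1 / 2 : ℂ) ^ j / j.factorial) * J z k j‖ ≤ A * κ ^ n * ‖z‖ ^ (-(β + 1)) := by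
    intro z hz
    have hT : ∀ k j : ℕ, IntegrableOn (fun t : ℝ => c k * ((-1 / 2 : ℂ) ^ j / j.factorial) *
        (endpointTerm φ a (k + j) j κ t * Complex.exp (-z * t))) (Ioi 0) := fun k j =>
      ((symbolFamily_endpointTerm (a := a) hφ le_rfl (k + j) j 1).integrableOn_mul_exp
        (by have := re_half_add_nat_gt ha (k + j); linarith) hκ hz).const_mul _
    have hTJ : ∀ k j : ℕ, ∫ t in Ioi (0 : ℝ), endpointTerm φ a (k + j) j κ t *
        Complex.exp (-z * t) = J z k j := fun k j =>
      integral_cpow_mul_eulerFalling_mul_exp hφ (re_half_add_nat_gt ha (k + j)) hκ hτ hz j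
    have hsum : Integrable (fun t : ℝ => ∑ k ∈ Finset.range (M + 1),
        ∑ j ∈ Finset.range (M + 1 - k), c k * ((-1 / 2 : ℂ) ^ j / j.factorial) *
          (endpointTerm φ a (k + j) j κ t * Complex.exp (-z * t))) (volume.restrict (Ioi 0)) :=
      integrable_finsetSum _ fun k _ => integrable_finsetSum _ fun j _ => hT k j
    have hGz : Integrable (fun t : ℝ => G t * Complex.exp (-z * t))
        (volume.restrict (Ioi 0)) := by
      refine Integrable.mul_bdd (c := 1) hGint (Continuous.aestronglyMeasurable (by fun_prop)) ?_
      filter_upwards [ae_restrict_mem measurableSet_Ioi] with t ht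
      rw [norm_exp_neg_mul_ofReal, Real.exp_le_one_iff]
      nlinarith [mul_pos hz (show (0 : ℝ) < t from ht)]
    have h1 := hA κ hκ z hz
    have h2 : ∫ t in Ioi (0 : ℝ), (endpointIntegrand φ g a κ t -
        ∑ k ∈ Finset.range (M + 1), ∑ j ∈ Finset.range (M + 1 - k),
          c k * ((-1 / 2 : ℂ) ^ j / j.factorial) * endpointTerm φ a (k + j) j κ t) *
            Complex.exp (-z * t) = (∫ t in Ioi (0 : ℝ), G t * Complex.exp (-z * t)) -
      ∑ k ∈ Finset.range (M + 1), ∑ j ∈ Finset.range (M + 1 - k),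
        c k * ((-1 / 2 : ℂ) ^ j / j.factorial) * J z k j := by
      simp only [sub_mul, Finset.sum_mul, mul_assoc _ (endpointTerm φ a _ _ κ _)]
      rw [integral_sub hGz hsum, integral_finsetSum _ fun k _ =>
        integrable_finsetSum _ fun j _ => hT k j]
      congr 1
      refine Finset.sum_congr rfl fun k _ => ?_
      rw [integral_finsetSum _ fun j _ => hT k j]
      refine Finset.sum_congr rfl fun j _ => ?_
      rw [integral_const_mul, hTJ]
    rw [h2] at h1
    exact h1
  -- passage to the imaginary axis
  have hlim1 : Tendsto (fun ε : ℝ => ∫ t in Ioi (0 : ℝ), G t *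
      Complex.exp (-((ε : ℂ) + η * Complex.I) * t)) (𝓝[>] 0)
      (𝓝 (∫ t in Ioi (0 : ℝ), G t * Complex.exp (-(η * Complex.I) * t))) := by
    refine tendsto_integral_filter_of_dominated_convergence (fun t => ‖G t‖) ?_ ?_ hGint.norm ?_
    · exact Eventually.of_forall fun ε => hGint.aestronglyMeasurable.mul
        (Continuous.aestronglyMeasurable (by fun_prop))
    · filter_upwards [self_mem_nhdsWithin] with ε hε
      filter_upwards [ae_restrict_mem measurableSet_Ioi] with t ht
      rw [norm_mul, norm_exp_neg_mul_ofReal]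
      refine mul_le_of_le_one_right (norm_nonneg _) (Real.exp_le_one_iff.2 ?_)
      simp
      exact mul_nonneg (le_of_lt hε) (le_of_lt ht)
    · refine Eventually.of_forall fun t => Tendsto.const_mul _ ?_
      have : Tendsto (fun ε : ℝ => Complex.exp (-((ε : ℂ) + η * Complex.I) * t)) (𝓝 0)
          (𝓝 (Complex.exp (-(η * Complex.I) * t))) :=
        Continuous.tendsto' (by fun_prop) _ _ (by simp)
      exact this.mono_left nhdsWithin_le_nhds
  have hlim2 : Tendsto (fun ε : ℝ => ∑ k ∈ Finset.range (M + 1), ∑ j ∈ Finset.range (M + 1 - k),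
      c k * ((-1 / 2 : ℂ) ^ j / j.factorial) * J ((ε : ℂ) + η * Complex.I) k j) (𝓝[>] 0)
      (𝓝 (∑ k ∈ Finset.range (M + 1), ∑ j ∈ Finset.range (M + 1 - k),
        c k * ((-1 / 2 : ℂ) ^ j / j.factorial) * J (η * Complex.I) k j)) :=
    tendsto_finsetSum _ fun k _ => tendsto_finsetSum _ fun j _ => Tendsto.const_mul _
      (Tendsto.const_mul _ (tendsto_integral_laplaceKernel hφ
        (re_half_add_nat_gt ha (k + j)) hκ hτ hη j))
  refine le_of_tendsto (hlim1.sub hlim2).norm ?_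
  filter_upwards [self_mem_nhdsWithin] with ε hε
  refine (hright _ (by simpa using hε)).trans ?_
  have h3 : |η| ≤ ‖(ε : ℂ) + η * Complex.I‖ := by
    simpa using Complex.abs_im_le_norm ((ε : ℂ) + η * Complex.I)
  have h4 : ‖(ε : ℂ) + η * Complex.I‖ ^ (-(β + 1)) ≤ |η| ^ (-(β + 1)) :=
    Real.rpow_le_rpow_of_nonpos (abs_pos.2 hη) h3 (by linarith)
  calc A * κ ^ n * ‖(ε : ℂ) + η * Complex.I‖ ^ (-(β + 1))
      ≤ |A| * κ ^ n * ‖(ε : ℂ) + η * Complex.I‖ ^ (-(β + 1)) := by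
        gcongr
        exact le_abs_self A
    _ ≤ |A| * κ ^ n * |η| ^ (-(β + 1)) := by gcongr

end Endpoint

theorem sum_range_sum_range_sub_eq_sum_antidiagonal (f : ℕ → ℕ → ℂ) (N : ℕ) :
    ∑ k ∈ Finset.range N, ∑ j ∈ Finset.range (N - k), f k j =
      ∑ m ∈ Finset.range N, ∑ p ∈ Finset.HasAntidiagonal.antidiagonal m, f p.2 p.1 := by
  rw [← Finset.sum_range_diag_flip]
  refine Finset.sum_congr rfl fun m _ => ?_
  rw [← Finset.Nat.sum_antidiagonal_swap, ← Finset.Nat.sum_antidiagonal_eq_sum_range_succ f m]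
  simp

theorem singularWeight_one_sub {a : ℂ} {h : ℝ → ℂ} {t : ℝ} (ht : t ∈ Ioo (0 : ℝ) 2) :
    singularWeight a h (1 - t) =
      (t : ℂ) ^ (a / 2) * (((2 - t : ℝ) : ℂ) ^ (a / 2) * h (1 - t)) := by
  have h2 : 0 < 2 - t := by linarith [ht.2]
  rw [singularWeight, show 1 - (1 - t) ^ 2 = t * (2 - t) by ring,
    abs_of_pos (mul_pos ht.1 h2), Complex.ofReal_mul,
    Complex.mul_cpow_ofReal_nonneg ht.1.le h2.le, mul_assoc]

theorem contDiffOn_endpointFactor {a : ℂ} {h : ℝ → ℂ} (hh : ContDiffOn ℝ ∞ h (Icc (-1) 1)) :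
    ContDiffOn ℝ ∞ (fun t : ℝ => ((2 - t : ℝ) : ℂ) ^ (a / 2) * h (1 - t)) (Icc 0 (7 / 4)) := by
  have h1 : ContDiffOn ℝ ∞ (fun t : ℝ => Complex.exp (((Real.log (2 - t) : ℝ) : ℂ) * (a / 2)))
      (Icc 0 (7 / 4)) := by
    have h2 : ContDiffOn ℝ ∞ (fun t : ℝ => Real.log (2 - t)) (Icc 0 (7 / 4)) :=
      ContDiffOn.log (by fun_prop) fun t ht => by have := ht.2; linarith
    exact ((Complex.ofRealCLM.contDiff.comp_contDiffOn h2).mul contDiffOn_const).cexp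
  have h3 : ContDiffOn ℝ ∞ (fun t : ℝ => h (1 - t)) (Icc 0 (7 / 4)) :=
    hh.comp (f := fun t : ℝ => 1 - t) (by fun_prop)
      fun t ht => ⟨by linarith [ht.2], by linarith [ht.1]⟩
  refine (h1.mul h3).congr fun t ht => ?_
  have h2 : 0 < 2 - t := by linarith [ht.2]
  rw [Complex.cpow_def_of_ne_zero (by exact_mod_cast h2.ne'), ← Complex.ofReal_log h2.le]

theorem isBigO_endpointFactor {a : ℂ} {h : ℝ → ℂ} {c : ℕ → ℂ}
    (hc : HasAsympExpansion (fun x => singularWeight a h (1 - x)) (a / 2) c) (N : ℕ) :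
    (fun t : ℝ => ((2 - t : ℝ) : ℂ) ^ (a / 2) * h (1 - t) -
      ∑ k ∈ Finset.range (N + 1), c k * (t : ℂ) ^ k) =O[𝓝[>] 0] fun t : ℝ => t ^ (N + 1) := by
  obtain ⟨B, hB⟩ := (hc N).bound
  refine Asymptotics.IsBigO.of_bound B ?_
  filter_upwards [hB, Ioo_mem_nhdsGT (zero_lt_two (α := ℝ))] with t ht ht2
  have ht0 := ht2.1
  rw [singularWeight_one_sub ht2, abs_of_pos ht0, ← mul_sub, norm_mul,
    Complex.norm_cpow_eq_rpow_re_of_pos ht0, Real.norm_of_nonneg (by positivity),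
    show (a / 2).re + N + 1 = (a / 2).re + ((N + 1 : ℕ) : ℝ) by push_cast; ring,
    Real.rpow_add ht0, Real.rpow_natCast, mul_left_comm] at ht
  rw [Real.norm_of_nonneg (by positivity)]
  exact le_of_mul_le_mul_left ht (Real.rpow_pos_of_pos ht0 _)

/-- The contribution of the endpoint `x = 1`, cut out by `cutoff (1 - x)`. -/
theorem exists_norm_endpoint_sub_mellinBarnes_le {φ h : ℝ → ℂ} {a : ℂ} {c : ℕ → ℂ} {n : ℝ}
    (hφ : IsSchwartzOnPos φ) (ha : -2 < a.re) (hh : ContDiffOn ℝ ∞ h (Icc (-1) 1))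
    (hc : HasAsympExpansion (fun x => singularWeight a h (1 - x)) (a / 2) c) (hn : 0 ≤ n) (M : ℕ) :
    ∃ A : ℝ, ∀ τ : ℝ, 0 < τ → ∀ C : ℝ, 0 < C → ∀ D : ℝ, D ≠ 0 →
      IntegrableOn (fun t : ℝ => cutoff t *
        (singularWeight a h (1 - t) * φ (C / √(1 - (1 - t) ^ 2)) * addE ((1 - t) * D))) (Ioo 0 2) ∧
      ‖(∫ t in Ioo (0 : ℝ) 2, cutoff t *
        (singularWeight a h (1 - t) * φ (C / √(1 - (1 - t) ^ 2)) * addE ((1 - t) * D))) -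
        ∑ m ∈ Finset.range (M + 1), addE D * mellinBarnes a c m τ φ (-(C ^ 2 * D)) /
          ((-D : ℝ) : ℂ) ^ ((m : ℂ) + 1 + a / 2)‖ ≤
        A * ((C ^ 2 * |D|) ^ (-n) * |D| ^ (-((M : ℝ) + 2 + a.re / 2))) := by
  set g : ℝ → ℂ := fun t => ((2 - t : ℝ) : ℂ) ^ (a / 2) * h (1 - t) with hg
  have hgs : ContDiffOn ℝ ∞ g (Icc 0 (7 / 4)) := contDiffOn_endpointFactor hh
  have hgc := isBigO_endpointFactor hc
  obtain ⟨A, hA⟩ := exists_norm_integral_endpoint_sub_le hφ ha hgs hgc hn M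
  have hpi := Real.pi_pos
  refine ⟨A * 2 ^ n * (2 * Real.pi) ^ (-(a.re / 2 + (M + 1) + n + 1)),
    fun τ hτ C hC D hD => ?_⟩
  have hκ : 0 < 2 / C ^ 2 := by positivity
  have hη : 2 * Real.pi * D ≠ 0 := mul_ne_zero (by positivity) hD
  have h1 := hA (2 / C ^ 2) hκ τ hτ (2 * Real.pi * D) hη
  have hGint := integrableOn_endpointIntegrand hφ ha hgs hgc hκ
  set G := endpointIntegrand φ g a (2 / C ^ 2) with hG
  have haddE : ∀ t : ℝ, addE ((1 - t) * D) =
      addE D * Complex.exp (-(((2 * Real.pi * D : ℝ) : ℂ) * Complex.I) * t) := fun t => by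
    rw [addE, addE, ← Complex.exp_add]
    congr 1
    push_cast
    ring
  have hnormE : ∀ x : ℝ, ‖addE x‖ = 1 := fun x => by
    rw [addE, show 2 * (Real.pi : ℂ) * Complex.I * x = ((2 * Real.pi * x : ℝ) : ℂ) * Complex.I by
      push_cast; ring, Complex.norm_exp_ofReal_mul_I]
  have hF : ∀ t ∈ Ioo (0 : ℝ) 2, cutoff t *
      (singularWeight a h (1 - t) * φ (C / √(1 - (1 - t) ^ 2)) * addE ((1 - t) * D)) =
      addE D * (G t * Complex.exp (-(((2 * Real.pi * D : ℝ) : ℂ) * Complex.I) * t)) := by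
    intro t ht
    have h2 : 0 < 1 - (1 - t) ^ 2 := by nlinarith [ht.1, ht.2]
    have h3 : (2 / C ^ 2 * (t - t ^ 2 / 2)) ^ (-(1 / 2) : ℝ) = C / √(1 - (1 - t) ^ 2) := by
      rw [show 2 / C ^ 2 * (t - t ^ 2 / 2) = (1 - (1 - t) ^ 2) / C ^ 2 by field_simp; ring,
        Real.rpow_neg (by positivity), ← Real.sqrt_eq_rpow, Real.sqrt_div h2.le,
        Real.sqrt_sq hC.le, inv_div]
    rw [hG, endpointIntegrand, invSqrtDeriv, h3, singularWeight_one_sub ht, haddE, eulerFalling]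
    simp only [hg, pow_zero, inv_one, one_mul]
    ring
  have hGe : IntegrableOn (fun t : ℝ => addE D *
      (G t * Complex.exp (-(((2 * Real.pi * D : ℝ) : ℂ) * Complex.I) * t))) (Ioi 0) := by
    refine (Integrable.mul_bdd (c := 1) hGint (Continuous.aestronglyMeasurable (by fun_prop))
      (Eventually.of_forall fun t => ?_)).const_mul _
    rw [norm_exp_neg_mul_ofReal]
    simp
  refine ⟨(hGe.mono_set (fun t ht => ht.1)).congr_fun (fun t ht => (hF t ht).symm)
    measurableSet_Ioo, ?_⟩
  have h4 : ∫ t in Ioo (0 : ℝ) 2, cutoff t *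
      (singularWeight a h (1 - t) * φ (C / √(1 - (1 - t) ^ 2)) * addE ((1 - t) * D)) =
      addE D * ∫ t in Ioi (0 : ℝ),
        G t * Complex.exp (-(((2 * Real.pi * D : ℝ) : ℂ) * Complex.I) * t) := by
    rw [setIntegral_congr_fun measurableSet_Ioo hF, integral_const_mul]
    congr 1
    refine (setIntegral_eq_of_subset_of_forall_sdiff_eq_zero measurableSet_Ioi
      (fun t ht => ht.1) fun t ht => ?_).symm
    have h5 : 2 ≤ t := by
      by_contra h
      exact ht.2 ⟨ht.1, not_le.1 h⟩
    rw [hG, endpointIntegrand, cutoff_of_ge (by linarith)]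
    simp
  have h5 : ∑ m ∈ Finset.range (M + 1), addE D * mellinBarnes a c m τ φ (-(C ^ 2 * D)) /
      ((-D : ℝ) : ℂ) ^ ((m : ℂ) + 1 + a / 2) =
      addE D * ∑ k ∈ Finset.range (M + 1), ∑ j ∈ Finset.range (M + 1 - k),
        c k * ((-1 / 2 : ℂ) ^ j / j.factorial) * (1 / (2 * Real.pi) *
            ∫ y : ℝ, laplaceKernel (eulerFalling φ j) (a / 2 + (k + j : ℕ)) (2 / C ^ 2)
              (((2 * Real.pi * D : ℝ) : ℂ) * Complex.I) (τ + y * Complex.I)) := by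
    rw [sum_range_sum_range_sub_eq_sum_antidiagonal, Finset.mul_sum]
    refine Finset.sum_congr rfl fun m _ => ?_
    rw [mul_div_assoc, mellinBarnes_div hφ ha c m hτ hC.ne' hD]
    congr 1
    refine Finset.sum_congr rfl fun p hp => ?_
    rw [Finset.HasAntidiagonal.mem_antidiagonal] at hp
    rw [add_comm p.2 p.1, hp, show (-1 / 2 : ℂ) = (-2)⁻¹ by norm_num, inv_pow]
    ring
  rw [h4, h5, ← mul_sub, norm_mul, hnormE, one_mul]
  refine h1.trans (le_of_eq ?_)
  have hD0 : 0 < |D| := abs_pos.2 hD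
  have hC2 : 0 < C ^ 2 := by positivity
  have hre : (a / 2).re = a.re / 2 := by simp
  rw [hre, abs_mul, abs_of_pos (by positivity : 0 < 2 * Real.pi),
    Real.mul_rpow (by positivity) hD0.le, Real.div_rpow zero_le_two hC2.le,
    Real.mul_rpow hC2.le hD0.le, Real.rpow_neg hC2.le,
    show -(a.re / 2 + ((M : ℝ) + 1) + n + 1) = -n + -((M : ℝ) + 2 + a.re / 2) by ring,
    Real.rpow_add hD0]
  ring

/-! ### Both endpoints -/

theorem theoremA
    (a : ℂ) (ha : -2 < a.re)
    (h₁ : ℝ → ℂ) (hh₁ : ContDiffOn ℝ ∞ h₁ (Icc (-1) 1))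
    -- the coefficients of the expansions at `1` and at `-1`
    (cp cm : ℕ → ℂ)
    (hcp : HasAsympExpansion (fun x => singularWeight a h₁ (1 - x)) (a / 2) cp)
    (hcm : HasAsympExpansion (fun x => singularWeight a h₁ (-(1 - x))) (a / 2) cm)
    -- `σ` is the sign of `C`; a Schwartz function on `ℝ` satisfies `hΦ` for both signs
    (σ : ℝ) (hσ : σ = 1 ∨ σ = -1)
    (Φ : ℝ → ℂ) (hΦ : IsSchwartzOnPos fun y => Φ (σ * y))
    (M : ℕ)
    (τ₁ : ℝ)
    (hτ₁ : 0 < τ₁ ∨ (τ₁ = 0 ∧ MellinAtMostSimplePoleAtZero fun y => Φ (σ * y))) :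
    ∃ K : ℝ, ∀ τ : ℝ, 0 < τ → ∀ C D : ℝ, 0 < σ * C → D ≠ 0 →
      IntervalIntegrable
        (fun x : ℝ => singularWeight a h₁ x * Φ (C / √(1 - x ^ 2)) * addE (x * D)) volume (-1) 1 ∧
      (∀ m : ℕ,
        Integrable (fun t : ℝ => transformIntegrand a cp m (fun y => Φ (σ * y))
          (-(C ^ 2 * D)) (τ + t * Complex.I)) ∧
        Integrable (fun t : ℝ => transformIntegrand a cm m (fun y => Φ (σ * y))
          (C ^ 2 * D) (τ + t * Complex.I))) ∧
      ‖(∫ x in (-1 : ℝ)..1, singularWeight a h₁ x * Φ (C / √(1 - x ^ 2)) * addE (x * D))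
          - ∑ m ∈ Finset.range (M + 1),
              (addE D * mellinBarnes a cp m τ (fun y => Φ (σ * y)) (-(C ^ 2 * D))
                  / ((-D : ℝ) : ℂ) ^ ((m : ℂ) + 1 + a / 2)
                + addE (-D) * mellinBarnes a cm m τ (fun y => Φ (σ * y)) (C ^ 2 * D)
                  / (D : ℂ) ^ ((m : ℂ) + 1 + a / 2))‖
        ≤ K * ((C ^ 2 * |D|) ^ (-τ₁) * |D| ^ (-((M : ℝ) + 2 + a.re / 2))) := by
  have hn : 0 ≤ τ₁ := hτ₁.elim le_of_lt fun h => h.1.ge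
  have hσσ : σ * σ = 1 := by rcases hσ with rfl | rfl <;> norm_num
  have hneg : ContDiffOn ℝ ∞ (fun x => h₁ (-x)) (Icc (-1) 1) :=
    hh₁.comp (f := fun x : ℝ => -x) (by fun_prop)
      fun x hx => ⟨by linarith [hx.2], by linarith [hx.1]⟩
  have hcm' : HasAsympExpansion (fun x => singularWeight a (fun x => h₁ (-x)) (1 - x)) (a / 2)
      cm := by
    have h : (fun x => singularWeight a (fun x => h₁ (-x)) (1 - x)) =
        fun x => singularWeight a h₁ (-(1 - x)) := by
      funext x
      rw [singularWeight, singularWeight, neg_sq]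
    rwa [h]
  obtain ⟨A, hA⟩ := exists_norm_endpoint_sub_mellinBarnes_le hΦ ha hh₁ hcp hn M
  obtain ⟨B, hB⟩ := exists_norm_endpoint_sub_mellinBarnes_le hΦ ha hneg hcm' hn M
  refine ⟨A + B, fun τ hτ C D hC hD => ?_⟩
  have hC0 : C ≠ 0 := by rintro rfl; simp at hC
  have hCsq : (σ * C) ^ 2 = C ^ 2 := by rw [mul_pow, sq σ, hσσ, one_mul]
  have hΦC : ∀ r : ℝ, Φ (σ * (σ * C / r)) = Φ (C / r) := fun r => by
    rw [mul_div_assoc, ← mul_assoc, hσσ, one_mul]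
  obtain ⟨hp, hAp⟩ := hA τ hτ (σ * C) hC D hD
  obtain ⟨hq, hBq⟩ := hB τ hτ (σ * C) hC (-D) (neg_ne_zero.2 hD)
  set f : ℝ → ℂ := fun x => singularWeight a h₁ x * Φ (C / √(1 - x ^ 2)) * addE (x * D) with hf
  have hpf : (fun t : ℝ => cutoff t * (singularWeight a h₁ (1 - t) *
      Φ (σ * (σ * C / √(1 - (1 - t) ^ 2))) * addE ((1 - t) * D))) =
      fun t => cutoff t * f (1 - t) := by
    funext t
    rw [hΦC]
  have hqf : (fun t : ℝ => cutoff t * (singularWeight a (fun x => h₁ (-x)) (1 - t) *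
      Φ (σ * (σ * C / √(1 - (1 - t) ^ 2))) * addE ((1 - t) * -D))) =
      fun t => cutoff t * f (-(1 - t)) := by
    funext t
    rw [hΦC, hf]
    simp only [singularWeight, neg_sq, neg_mul, mul_neg]
  rw [hpf] at hp hAp
  rw [hqf] at hq hBq
  rw [hCsq] at hAp hBq
  have hp' : IntervalIntegrable (fun t => cutoff t * f (1 - t)) volume 0 2 :=
    (intervalIntegrable_iff_integrableOn_Ioo_of_le zero_le_two).2 hp
  have hq' : IntervalIntegrable (fun t => cutoff t * f (-(1 - t))) volume 0 2 :=
    (intervalIntegrable_iff_integrableOn_Ioo_of_le zero_le_two).2 hq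
  have hq'' : IntervalIntegrable (fun t => cutoff (2 - t) * f (1 - t)) volume 0 2 := by
    have h := (hq'.comp_sub_left 2).symm
    norm_num at h
    refine h.congr fun t _ => ?_
    ring_nf
  -- the cutoff and its reflection form a partition of unity
  have hsplit : (fun t => f (1 - t)) =
      fun t => cutoff t * f (1 - t) + cutoff (2 - t) * f (1 - t) := by
    funext t
    rw [← add_mul, cutoff_add_cutoff, one_mul]
  have hfint : IntervalIntegrable (fun t => f (1 - t)) volume 0 2 := by
    rw [hsplit]
    exact hp'.add hq''
  have hI : ∫ x in (-1 : ℝ)..1, f x = (∫ t in Ioo (0 : ℝ) 2, cutoff t * f (1 - t)) +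
      ∫ t in Ioo (0 : ℝ) 2, cutoff t * f (-(1 - t)) := by
    have h1 : ∫ x in (-1 : ℝ)..1, f x = ∫ t in (0 : ℝ)..2, f (1 - t) := by
      rw [intervalIntegral.integral_comp_sub_left]
      norm_num
    have h2 : ∫ t in (0 : ℝ)..2, cutoff (2 - t) * f (1 - t) =
        ∫ t in (0 : ℝ)..2, cutoff t * f (-(1 - t)) := by
      have h3 := intervalIntegral.integral_comp_sub_left (a := (0 : ℝ)) (b := 2)
        (fun t => cutoff t * f (-(1 - t))) 2
      rw [sub_self, sub_zero] at h3
      rw [← h3]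
      refine intervalIntegral.integral_congr fun t _ => ?_
      ring_nf
    rw [h1, hsplit, intervalIntegral.integral_add hp' hq'', h2,
      intervalIntegral.integral_of_le zero_le_two, intervalIntegral.integral_of_le zero_le_two,
      integral_Ioc_eq_integral_Ioo, integral_Ioc_eq_integral_Ioo]
  refine ⟨?_, fun m => ⟨integrable_transformIntegrand hΦ ha cp m hτ hC0 hD, ?_⟩, ?_⟩
  · have h := (hfint.comp_sub_left 1).symm
    norm_num at h
    exact h
  · simpa using integrable_transformIntegrand hΦ ha cm m hτ hC0 (neg_ne_zero.2 hD)
  · rw [hI, Finset.sum_add_distrib, add_sub_add_comm, add_mul]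
    refine (norm_add_le _ _).trans (add_le_add hAp ?_)
    simpa only [mul_neg, neg_neg, abs_neg] using hBq
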